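/- All graphs are finite, undirected and simple. A graph $G$ is bicyclic if it is connected and $|E_G|=|V_G|+1$. The Wiener index of a connected graph $G$ is $W(G)=\sum_{\{u,v\}\subseteq V_G}d_G(u,v)$. Let $P_m$ and $C_m$ be the path and the cycle with $m$ vertices, and let $K_4^-$ be $K_4$ with one edge deleted. Let $B_n^{(1)}$ be the $n$-vertex graph obtained by identifying an end-vertex of $P_{n-3}$ with a vertex of degree $3$ of $K_4^-$. For $0\le s\le\lfloor\frac{n-4}{2}\rfloor$ let $B(n,s)$ be the $n$-vertex graph obtained by attaching (joining by an edge to an end-vertex) the paths $P_{n-s-4}$ and $P_s$, respectively, to the two vertices of degree $2$ of $K_4^-$, where $P_0$ is empty. Let $B_n^{3,3}$ be the $n$-vertex graph obtained by joining two triangles $C_3$ by a path of length $n-5$. Theorem. Let $n\ge 6$. The graphs $B(n,0)$, $B(n,1)$, $B_n^{(1)}$, $B_n^{3,3}$ are bicyclic graphs of order $n$, and $W(B_n^{(1)})=\frac{n^3-19n+54}{6}$. Let $G$ be any bicyclic graph of order $n$ that is not isomorphic to any of $B(n,0)$, $B(n,1)$, $B_n^{(1)}$, $B_n^{3,3}$.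 (i) If $n=6$, then $W(G)<W(B_6^{(1)})<W(B(6,1))=W(B_6^{3,3})<W(B(6,0))$. (ii) If $n=8$, then $B(8,2)$ is bicyclic, and if moreover $G\not\cong B(8,2)$, then $W(G)<W(B(8,2))=W(B_8^{(1)})<W(B(8,1))<W(B_8^{3,3})<W(B(8,0))$. (iii) If $n\ge 7$ and $n\ne 8$, then $W(G)<W(B_n^{(1)})<W(B(n,1))<W(B_n^{3,3})<W(B(n,0))$. The comparisons among the named graphs hold in each case whether or not such a $G$ exists. -/

import Mathlib

universe u

/-- The Wiener index of a graph: the sum of the distances `d(u, v)` over all unordered pairs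
`{u, v}` of vertices (the degenerate pairs `{u, u}` contribute `0`). -/
noncomputable def wienerIndex {V : Type*} [Fintype V] (G : SimpleGraph V) : ℕ :=
  ∑ e ∈ (Finset.univ : Finset V).sym2,
    Sym2.lift ⟨fun u v => G.dist u v, fun _ _ => SimpleGraph.dist_comm⟩ e

/-- A bicyclic graph: a connected finite graph with `|E| = |V| + 1`. -/
def IsBicyclic {V : Type*} [Fintype V] (G : SimpleGraph V) : Prop :=
  G.Connected ∧ G.edgeSet.ncard = Fintype.card V + 1

/-- The graph `B(n, s)`, for `s + 4 ≤ n`: two paths `P_s` and `P_{n-s-4}` attached to the two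
vertices of degree 2 of `K₄⁻`, that is, of `K₄` minus an edge.
Here `K₄⁻` lives on `s, s + 1, s + 2, s + 3`, the missing edge being `{s, s + 3}`; the path `P_s` is
`0, …, s - 1`, with `s - 1` joined to `s`, and `P_{n-s-4}` is `s + 4, …, n - 1`, with `s + 4` joined
to `s + 3`. -/
def graphB (n s : ℕ) : SimpleGraph (Fin n) :=
  SimpleGraph.fromRel fun i j : Fin n =>
    (i.val < j.val ∧ s ≤ i.val ∧ j.val ≤ s + 3 ∧ ¬ (i.val = s ∧ j.val = s + 3)) ∨
    (j.val = i.val + 1 ∧ (j.val ≤ s ∨ s + 3 ≤ i.val))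

/-- The graph `B_n^{(1)}`, for `4 ≤ n`: an end-vertex of the path `P_{n-3}` is identified with a
vertex of degree 3 of `K₄⁻`.
Here `K₄⁻` lives on `0, 1, 2, 3`, the missing edge being `{0, 1}`, so that `2` and `3` have degree 3
in it; the path `P_{n-3}` is `3, 4, …, n - 1`. -/
def graphBOne (n : ℕ) : SimpleGraph (Fin n) :=
  SimpleGraph.fromRel fun i j : Fin n =>
    (i.val < j.val ∧ j.val ≤ 3 ∧ ¬ (i.val = 0 ∧ j.val = 1)) ∨
    (3 ≤ i.val ∧ j.val = i.val + 1)

/-- The graph `B_n^{p,q}`, for `3 ≤ p`, `3 ≤ q`, `p + q ≤ n + 1`: the cycles `C_p` and `C_q` joined by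
a path of length `n - p - q + 1`.
Here `C_p` is `0, 1, …, p - 1`, closed by the edge `{0, p - 1}`, the joining path is
`p - 1, p, …, n - q`, and `C_q` is `n - q, …, n - 1`, closed by the edge `{n - q, n - 1}`. -/
def graphBCycles (n p q : ℕ) : SimpleGraph (Fin n) :=
  SimpleGraph.fromRel fun i j : Fin n =>
    j.val = i.val + 1 ∨
    (i.val = 0 ∧ j.val + 1 = p) ∨
    (i.val + q = n ∧ j.val + 1 = n)

/-!
The proof is by induction on the number `n` of vertices, deleting a vertex `v` that is not a cut
vertex. Distances can only grow, so `W(G) ≤ W(G - v) + D(v)`, where the transmission `D(v)` is the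
sum of the distances from `v` (`wienerIndex_le_induce_add`). Write
`f(n) = (n³ - 19n + 54) / 6 = W(B_n^{(1)})` and `Δ(n) = f(n) - f(n - 1) = (n² - n - 6) / 2`. The
inductive statement (`six_mul_wienerIndex_le_of_isBicyclic`) is that `W(G) ≤ f(n)` unless `G` is
`B(n, 0)`, `B(n, 1)` or `B_n^{3,3}`; the strict inequality at `n` follows from this at `n - 1`.

*Pendant vertices.* If `v` is pendant with neighbour `u`, then `D_G(v) = (n - 1) + D_{G - v}(u)` and
`Δ(n) = (n - 1) + Δ(n - 1)`, so the sign of `D(v) - Δ(n)` does not change when `(G, v)` is replaced by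
`(G - v, u)`. As a vertex with two neighbours has `D(v) < Δ(n)` for `n ≥ 6`, peeling off pendant
vertices shows that `D(v) ≥ Δ(n)` only if `v` ends the long path of `B(n, 0)`, `B(n, 1)` or
`B_n^{(1)}` (`exists_iso_of_le_transmission`). In all other cases
`W(G) ≤ W(G - v) + Δ(n) - 1 ≤ f(n) - 1` if the induction hypothesis applies to `G - v`. When `G - v`
is one of the three exceptions of order `n - 1`, the transmission of `u` in it is computed or bounded
directly, and either `W(G) < f(n)` or `G` is an exception again
(`six_mul_wienerIndex_add_six_le_of_pendant`).

*No pendant vertices.* A connected graph with at least as many edges as vertices has Wiener index at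
most `(n³ - 7n + 12) / 6` (`Connected.six_mul_wienerIndex_le_of_card_le`). If `v` has degree two, is
not a cut vertex and has at least two vertices at distance two, then this bound for `G - v` and the
bound for `D(v)` from counting the vertices in the distance levels of `v` give `W(G) < f(n)`
(`six_mul_wienerIndex_le_of_no_pendant`; for `n = 6` one distribution of levels needs a separate
look). If there is no such `v`, every vertex that is not a cut vertex lies in a triangle hanging at
a single vertex (`exists_pendant_triangle`), and the graph is `B_n^{3,3}`
(`nonempty_iso_graphBCycles`).

Inequalities between Wiener indices are stated for `6 * W` and transmissions for `2 * D`, with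
negative terms moved to the other side, to stay within the natural numbers.
-/

namespace SimpleGraph

/-! ### Distances, transmissions and the Wiener index -/

open Finset
open scoped Classical

variable {V : Type*} {W : Type*}

/-- The transmission of a vertex: the sum of its distances to all vertices. -/
noncomputable def transmission [Fintype V] (G : SimpleGraph V) (v : V) : ℕ :=
  ∑ x, G.dist v x

theorem two_mul_wienerIndex [Fintype V] (G : SimpleGraph V) :
    2 * wienerIndex G = ∑ v, G.transmission v := by
  unfold wienerIndex transmission
  set f : Sym2 V → ℕ := Sym2.lift ⟨fun u v => G.dist u v, fun _ _ => dist_comm⟩ with hf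
  have hfib : ∀ e : Sym2 V, ∑ p : V × V with s(p.1, p.2) = e, f s(p.1, p.2) = 2 * f e := by
    intro e
    induction e using Sym2.ind with
    | _ a b =>
      by_cases hab : a = b
      · subst hab
        rw [sum_congr rfl (g := fun _ => 0)]
        · simp [hf]
        · intro p hp
          rw [(mem_filter.1 hp).2]
          simp [hf]
      · have : (univ.filter fun p : V × V => s(p.1, p.2) = s(a, b)) = {(a, b), (b, a)} := by
          ext ⟨x, y⟩
          simp
        rw [this, sum_pair (by simp [hab])]
        have : s(b, a) = s(a, b) := Sym2.eq_swap
        simp only [this]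
        ring
  have h1 : ∑ p : V × V, f s(p.1, p.2) = ∑ e : Sym2 V, 2 * f e := by
    rw [← sum_fiberwise (s := univ) (g := fun p : V × V => s(p.1, p.2))]
    exact sum_congr rfl fun e _ => hfib e
  rw [← mul_sum] at h1
  have h2 : (univ : Finset V).sym2 = (univ : Finset (Sym2 V)) := by
    ext e; simp
  rw [h2, ← h1, Fintype.sum_prod_type]
  rfl

theorem dist_le_of_hom {G : SimpleGraph V} {H : SimpleGraph W} (hG : G.Connected) (f : G →g H)
    (u v : V) : H.dist (f u) (f v) ≤ G.dist u v := by
  obtain ⟨p, hp⟩ := hG.exists_walk_length_eq_dist u v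
  rw [← hp, ← Walk.length_map f p]
  exact dist_le _

theorem Iso.dist_eq {G : SimpleGraph V} {H : SimpleGraph W} (hG : G.Connected) (e : G ≃g H)
    (u v : V) : H.dist (e u) (e v) = G.dist u v := by
  refine le_antisymm (dist_le_of_hom hG e.toHom u v) ?_
  have hH : H.Connected := e.connected_iff.1 hG
  simpa using dist_le_of_hom hH e.symm.toHom (e u) (e v)

theorem Iso.transmission_eq [Fintype V] [Fintype W] {G : SimpleGraph V} {H : SimpleGraph W}
    (hG : G.Connected) (e : G ≃g H) (u : V) : H.transmission (e u) = G.transmission u := by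
  unfold transmission
  rw [← e.toEquiv.sum_comp]
  exact sum_congr rfl fun x _ => e.dist_eq hG u x

theorem Iso.wienerIndex_eq [Fintype V] [Fintype W] {G : SimpleGraph V} {H : SimpleGraph W}
    (hG : G.Connected) (e : G ≃g H) : wienerIndex G = wienerIndex H := by
  have h : 2 * wienerIndex G = 2 * wienerIndex H := by
    rw [two_mul_wienerIndex, two_mul_wienerIndex, ← e.toEquiv.sum_comp]
    exact sum_congr rfl fun x _ => (e.transmission_eq hG x).symm
  omega

theorem sum_ncard_neighborSet [Fintype V] (G : SimpleGraph V) :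
    ∑ v, (G.neighborSet v).ncard = 2 * G.edgeSet.ncard := by
  have := G.sum_degrees_eq_twice_card_edges
  rw [← coe_edgeFinset G, Set.ncard_coe_finset, ← this]
  refine sum_congr rfl fun v _ => ?_
  rw [← card_neighborFinset_eq_degree, Set.ncard_eq_toFinset_card']
  rfl

/-- A bijective homomorphism between finite graphs with equally many edges is an isomorphism. -/
theorem exists_iso_of_bijective_hom [Finite V] [Finite W] {G : SimpleGraph V} {H : SimpleGraph W}
    (f : V → W) (hf : Function.Bijective f) (hadj : ∀ u v, G.Adj u v → H.Adj (f u) (f v))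
    (hcard : H.edgeSet.ncard ≤ G.edgeSet.ncard) : ∃ e : G ≃g H, ∀ x, e x = f x := by
  have himg : Sym2.map f '' G.edgeSet = H.edgeSet := by
    refine Set.eq_of_subset_of_ncard_le ?_ ?_ (Set.toFinite _)
    · rintro _ ⟨e, he, rfl⟩
      induction e using Sym2.ind with
      | _ a b => exact hadj a b he
    · rw [Set.ncard_image_of_injective _ (Sym2.map.injective hf.1)]
      exact hcard
  refine ⟨⟨Equiv.ofBijective f hf, ?_⟩, fun x => rfl⟩
  intro a b
  refine ⟨fun h => ?_, hadj a b⟩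
  have : s(f a, f b) ∈ Sym2.map f '' G.edgeSet := himg ▸ h
  obtain ⟨e, he, hab⟩ := this
  rw [← Sym2.map_mk] at hab
  rw [Sym2.map.injective hf.1 hab] at he
  exact he

theorem Connected.reachable_map {G : SimpleGraph V} {H : SimpleGraph W} (hG : G.Connected)
    (f : V → W) (hf : ∀ u v, G.Adj u v → f u = f v ∨ H.Adj (f u) (f v)) (u v : V) :
    H.Reachable (f u) (f v) := by
  obtain ⟨p⟩ := hG.preconnected u v
  induction p with
  | nil => exact Reachable.refl _
  | cons h p ih =>
    rcases hf _ _ h with h | h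
    · rwa [h]
    · exact h.reachable.trans ih

theorem Connected.eq_univ_of_closed {G : SimpleGraph V} (hG : G.Connected) {S : Set V}
    (hS : S.Nonempty) (hcl : ∀ x ∈ S, ∀ y, G.Adj x y → y ∈ S) (y : V) : y ∈ S := by
  obtain ⟨x, hx⟩ := hS
  obtain ⟨p⟩ := hG.preconnected x y
  induction p with
  | nil => exact hx
  | cons h p ih => exact ih (hcl _ hx _ h)

/-- Distances from a fixed source are recognised by being `0` at the source, changing by at most
one along every edge, and decreasing along some edge at every other vertex. -/
theorem dist_eq_of_level {G : SimpleGraph V} (f : V → ℕ) (s : V) (h0 : f s = 0)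
    (hle : ∀ u v, G.Adj u v → f v ≤ f u + 1)
    (hdesc : ∀ v, v ≠ s → ∃ u, G.Adj u v ∧ f u + 1 = f v) (v : V) :
    G.Reachable s v ∧ G.dist s v = f v := by
  have hwalk : ∀ n v, f v = n → ∃ p : G.Walk s v, p.length = n := by
    intro n
    induction n with
    | zero =>
      intro v hv
      by_cases hvs : v = s
      · subst hvs; exact ⟨Walk.nil, rfl⟩
      · obtain ⟨u, -, hu⟩ := hdesc v hvs; omega
    | succ n ih =>
      intro v hv
      by_cases hvs : v = s
      · subst hvs; omega
      · obtain ⟨u, hu, huv⟩ := hdesc v hvs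
        obtain ⟨p, hp⟩ := ih u (by omega)
        exact ⟨p.concat hu, by simp [hp]⟩
  have hlow : ∀ u v (p : G.Walk u v), f v ≤ f u + p.length := by
    intro u v p
    induction p with
    | nil => simp
    | cons h p ih =>
      have := hle _ _ h
      simp only [Walk.length_cons]; omega
  obtain ⟨p, hp⟩ := hwalk _ v rfl
  refine ⟨p.reachable, le_antisymm (hp ▸ dist_le p) ?_⟩
  obtain ⟨q, hq⟩ := p.reachable.exists_walk_length_eq_dist
  have := hlow _ _ q
  omega

theorem Connected.exists_adj_dist_succ {G : SimpleGraph V} (hG : G.Connected) {v x : V}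
    (hx : x ≠ v) : ∃ y, G.Adj y x ∧ G.dist v y + 1 = G.dist v x := by
  obtain ⟨p, hp⟩ := hG.exists_walk_length_eq_dist v x
  have hpos := hG.pos_dist_of_ne hx.symm
  refine ⟨p.getVert (p.length - 1), ?_, ?_⟩
  · have := p.adj_getVert_succ (i := p.length - 1) (by omega)
    rwa [Nat.sub_add_cancel (by omega), p.getVert_length] at this
  · have h1 : G.dist v (p.getVert (p.length - 1)) ≤ p.length - 1 := by
      refine (dist_le (p.take (p.length - 1))).trans ?_
      simp
    have h2 : G.Adj (p.getVert (p.length - 1)) x := by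
      have := p.adj_getVert_succ (i := p.length - 1) (by omega)
      rwa [Nat.sub_add_cancel (by omega), p.getVert_length] at this
    have h3 := hG.dist_triangle (u := v) (v := p.getVert (p.length - 1)) (w := x)
    rw [dist_eq_one_iff_adj.2 h2] at h3
    omega

theorem Connected.dist_le_succ_of_adj {G : SimpleGraph V} (hG : G.Connected) {v x y : V}
    (h : G.Adj x y) : G.dist v y ≤ G.dist v x + 1 := by
  have h3 := hG.dist_triangle (u := v) (v := x) (w := y)
  rwa [dist_eq_one_iff_adj.2 h] at h3

theorem Connected.dist_eq_two {G : SimpleGraph V} (hG : G.Connected) {v x y : V}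
    (h1 : G.Adj v x) (h2 : G.Adj x y) (hne : y ≠ v) (hn : ¬ G.Adj v y) : G.dist v y = 2 := by
  have h3 := hG.dist_le_succ_of_adj (v := v) h2
  rw [dist_eq_one_iff_adj.2 h1] at h3
  have := hG.one_lt_dist_of_ne_of_not_adj hne.symm hn
  omega

end SimpleGraph

namespace SimpleGraph

/-! ### Deleting a vertex -/

open Finset
open scoped Classical

variable {V : Type*}

theorem sum_eq_add_sum_compl_singleton [Fintype V] (v : V) (g : V → ℕ) :
    ∑ x, g x = g v + ∑ x : ({v}ᶜ : Set V), g x := by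
  rw [← add_sum_erase univ g (mem_univ v)]
  congr 1
  rw [← Finset.sum_coe_sort]
  refine Fintype.sum_equiv (Equiv.subtypeEquivRight fun x => ?_) _ _ fun x => rfl
  simp

theorem card_compl_singleton_add_one [Fintype V] (v : V) :
    Fintype.card ({v}ᶜ : Set V) + 1 = Fintype.card V := by
  have h := sum_eq_add_sum_compl_singleton v fun _ => 1
  simp only [sum_const, smul_eq_mul, mul_one] at h
  rw [Fintype.card, Fintype.card, h]
  omega

theorem ncard_edgeSet_eq_add [Fintype V] (G : SimpleGraph V) (v : V) :
    G.edgeSet.ncard = (G.induce {v}ᶜ).edgeSet.ncard + (G.neighborSet v).ncard := by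
  have h := (G.card_edgeFinset_induce_compl_singleton v).trans
    (G.card_edgeFinset_deleteIncidenceSet v)
  have h2 := G.degree_le_card_edgeFinset v
  have h3 : (G.neighborSet v).ncard = G.degree v := by
    rw [← card_neighborFinset_eq_degree, Set.ncard_eq_toFinset_card']
    rfl
  simp only [← Set.ncard_coe_finset, coe_edgeFinset] at h h2
  rw [h3]
  omega

theorem wienerIndex_le_induce_add [Fintype V] {G : SimpleGraph V} {v : V} (h : (G.induce {v}ᶜ).Connected) :
    wienerIndex G ≤ wienerIndex (G.induce {v}ᶜ) + G.transmission v := by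
  have hd : ∀ x y : ({v}ᶜ : Set V), G.dist x y ≤ (G.induce {v}ᶜ).dist x y := fun x y =>
    dist_le_of_hom h (Embedding.induce _).toHom x y
  have h1 := two_mul_wienerIndex G
  have h2 := two_mul_wienerIndex (G.induce {v}ᶜ)
  rw [sum_eq_add_sum_compl_singleton v] at h1
  have h3 : ∑ x : ({v}ᶜ : Set V), G.transmission x
      ≤ ∑ x : ({v}ᶜ : Set V), (G.dist v x + (G.induce {v}ᶜ).transmission x) := by
    refine sum_le_sum fun x _ => ?_
    unfold transmission
    rw [sum_eq_add_sum_compl_singleton v, dist_comm]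
    exact Nat.add_le_add_left (sum_le_sum fun y _ => hd x y) _
  rw [sum_add_distrib] at h3
  have h4 : G.transmission v = ∑ x : ({v}ᶜ : Set V), G.dist v x := by
    unfold transmission
    rw [sum_eq_add_sum_compl_singleton v]
    simp
  omega

/-- A vertex whose neighbours are all dominated by another vertex is not a cut vertex. -/
theorem Connected.induce_compl_of_dominated {G : SimpleGraph V} (hG : G.Connected) {v u : V}
    (huv : u ≠ v) (h : ∀ x, G.Adj v x → x = u ∨ G.Adj u x) : (G.induce {v}ᶜ).Connected := by
  let f : V → ({v}ᶜ : Set V) := fun x => if hx : x = v then ⟨u, huv⟩ else ⟨x, hx⟩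
  have hfv : f v = ⟨u, huv⟩ := by simp [f]
  have hf : ∀ x (hx : x ≠ v), f x = ⟨x, hx⟩ := fun x hx => by simp [f, hx]
  have key := hG.reachable_map (H := G.induce {v}ᶜ) f ?_
  · refine (connected_iff _).2 ⟨fun x y => ?_, ⟨⟨u, huv⟩⟩⟩
    have := key x y
    rwa [hf x x.2, hf y y.2] at this
  · intro x y hxy
    by_cases hx : x = v
    · subst hx
      have hy := hxy.ne'
      rw [hfv, hf y hy]
      rcases h y hxy with h | h
      · left; simp [h]
      · right; exact h
    · rw [hf x hx]
      by_cases hy : y = v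
      · subst hy
        rw [hfv]
        rcases h x hxy.symm with h | h
        · left; simp [h]
        · right; exact h.symm
      · rw [hf y hy]
        right; exact hxy

theorem Connected.induce_compl_of_pendant {G : SimpleGraph V} (hG : G.Connected) {v u : V}
    (h : ∀ x, G.Adj v x ↔ x = u) : (G.induce {v}ᶜ).Connected :=
  hG.induce_compl_of_dominated ((h u).2 rfl).ne' fun x hx => Or.inl ((h x).1 hx)

theorem dist_induce_of_pendant {G : SimpleGraph V} (hG : G.Connected) {v u : V}
    (h : ∀ x, G.Adj v x ↔ x = u) (x y : ({v}ᶜ : Set V)) :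
    (G.induce {v}ᶜ).dist x y = G.dist x y := by
  have hG' := hG.induce_compl_of_pendant h
  refine (dist_eq_of_level (G := G.induce {v}ᶜ) (fun y => G.dist x y) x (by simp) ?_ ?_ y).2
  · intro a b hab
    exact hG.dist_le_succ_of_adj hab
  · intro a ha
    obtain ⟨b, hb, hbd⟩ := hG.exists_adj_dist_succ (v := (x : V)) (x := (a : V))
      fun hh => ha (Subtype.ext hh)
    refine ⟨⟨b, ?_⟩, hb, hbd⟩
    rintro rfl
    -- the predecessor of `a` on a geodesic is the pendant vertex, so `a` is its neighbour and
    -- the predecessor of the pendant vertex as well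
    have ha' := (h _).1 hb
    by_cases hxb : (b : V) = x
    · exact x.2 hxb.symm
    · obtain ⟨c, hc, hcd⟩ := hG.exists_adj_dist_succ (v := (x : V)) hxb
      rw [(h _).1 hc.symm, ← ha'] at hcd
      omega

theorem transmission_of_pendant [Fintype V] {G : SimpleGraph V} (hG : G.Connected) {v u : V}
    (h : ∀ x, G.Adj v x ↔ x = u) :
    G.transmission v + 1
      = Fintype.card V + (G.induce {v}ᶜ).transmission ⟨u, ((h u).2 rfl).ne'⟩ := by
  have hd : ∀ x : ({v}ᶜ : Set V), G.dist v x = 1 + (G.induce {v}ᶜ).dist ⟨u, ((h u).2 rfl).ne'⟩ x := by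
    intro x
    rw [dist_induce_of_pendant hG h]
    have h1 := hG.dist_triangle (u := v) (v := u) (w := x)
    rw [dist_eq_one_iff_adj.2 ((h u).2 rfl)] at h1
    obtain ⟨y, hy, hyd⟩ := hG.exists_adj_dist_succ (v := (x : V)) (x := v) fun hh => x.2 hh.symm
    rw [(h y).1 hy.symm, dist_comm, dist_comm (u := (x : V))] at hyd
    simp only
    omega
  have h2 : G.transmission v = ∑ x : ({v}ᶜ : Set V), G.dist v x := by
    unfold transmission
    rw [sum_eq_add_sum_compl_singleton v]
    simp
  rw [h2, sum_congr rfl fun x _ => hd x, sum_add_distrib, ← card_compl_singleton_add_one v]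
  simp [transmission]
  omega

theorem ncard_neighborSet_of_pendant {G : SimpleGraph V} {v u : V}
    (h : ∀ x, G.Adj v x ↔ x = u) : (G.neighborSet v).ncard = 1 := by
  rw [Set.ncard_eq_one]
  exact ⟨u, Set.ext fun x => h x⟩

theorem isBicyclic_induce_of_pendant [Fintype V] {G : SimpleGraph V} (hG : IsBicyclic G) {v u : V}
    (h : ∀ x, G.Adj v x ↔ x = u) : IsBicyclic (G.induce {v}ᶜ) := by
  refine ⟨hG.1.induce_compl_of_pendant h, ?_⟩
  have h1 := ncard_edgeSet_eq_add G v
  have h2 := card_compl_singleton_add_one v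
  rw [ncard_neighborSet_of_pendant h, hG.2] at h1
  omega

theorem Connected.exists_adj [Fintype V] {G : SimpleGraph V} (hG : G.Connected) (hn : 2 ≤ Fintype.card V)
    (v : V) : ∃ u, G.Adj v u := by
  obtain ⟨x, hx⟩ := Fintype.exists_ne_of_one_lt_card (by omega : 1 < Fintype.card V) v
  obtain ⟨y, hy, -⟩ := hG.exists_adj_dist_succ (v := x) hx.symm
  exact ⟨y, hy.symm⟩

/-- In a connected graph with at least two vertices, a vertex is pendant or has two neighbours. -/
theorem Connected.pendant_or_two_neighbors [Fintype V] {G : SimpleGraph V} (hG : G.Connected)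
    (hn : 2 ≤ Fintype.card V) (v : V) :
    (∃ u, ∀ x, G.Adj v x ↔ x = u) ∨ ∃ a b, a ≠ b ∧ G.Adj v a ∧ G.Adj v b := by
  obtain ⟨u, hu⟩ := hG.exists_adj hn v
  by_cases h : ∃ b, b ≠ u ∧ G.Adj v b
  · obtain ⟨b, hb, hvb⟩ := h
    exact Or.inr ⟨b, u, hb, hvb, hu⟩
  · push Not at h
    exact Or.inl ⟨u, fun x => ⟨fun hx => by_contra fun hne => h x hne hx, fun hx => hx ▸ hu⟩⟩

/-- A vertex at maximal distance from some vertex is not a cut vertex. -/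
theorem Connected.induce_compl_of_farthest {G : SimpleGraph V} (hG : G.Connected) {s v : V}
    (hsv : s ≠ v) (h : ∀ x, G.dist s x ≤ G.dist s v) : (G.induce {v}ᶜ).Connected := by
  have hr : ∀ n (y : ({v}ᶜ : Set V)), G.dist s y = n → (G.induce {v}ᶜ).Reachable ⟨s, hsv⟩ y := by
    intro n
    induction n with
    | zero =>
      intro y hy
      rw [hG.dist_eq_zero_iff] at hy
      have : y = ⟨s, hsv⟩ := Subtype.ext hy.symm
      rw [this]
    | succ n ih =>
      intro y hy
      obtain ⟨z, hz, hzd⟩ := hG.exists_adj_dist_succ (v := s) (x := (y : V))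
        (by rintro hh; rw [hh, dist_self] at hy; omega)
      have hzv : z ≠ v := by
        rintro rfl
        have := h y
        omega
      exact (ih ⟨z, hzv⟩ (by simp only; omega)).trans (Adj.reachable (by exact hz))
  refine (connected_iff _).2 ⟨fun x y => ?_, ⟨⟨s, hsv⟩⟩⟩
  exact (hr _ x rfl).symm.trans (hr _ y rfl)

theorem exists_farthest [Fintype V] (G : SimpleGraph V) (s : V) : ∃ v, ∀ x, G.dist s x ≤ G.dist s v := by
  obtain ⟨v, -, hv⟩ := exists_max_image univ (fun x => G.dist s x) ⟨s, mem_univ s⟩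
  exact ⟨v, fun x => hv x (mem_univ x)⟩

theorem Connected.exists_farthest_ne [Fintype V] {G : SimpleGraph V} (hG : G.Connected)
    (hn : 2 ≤ Fintype.card V) (s : V) : ∃ v, s ≠ v ∧ ∀ x, G.dist s x ≤ G.dist s v := by
  obtain ⟨v, hv⟩ := G.exists_farthest s
  refine ⟨v, ?_, hv⟩
  rintro rfl
  obtain ⟨x, hx⟩ := Fintype.exists_ne_of_one_lt_card (by omega : 1 < Fintype.card V) s
  have h1 := hG.pos_dist_of_ne hx.symm
  have := hv x
  simp only [dist_self] at this
  omega

end SimpleGraph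

namespace SimpleGraph

/-! ### Bounding transmissions by distance levels -/

open Finset
open scoped Classical

variable {V : Type*} [Fintype V]

/-- The number of vertices at distance at least `k` from `v`. -/
noncomputable def numFar (G : SimpleGraph V) (v : V) (k : ℕ) : ℕ :=
  #{x | k ≤ G.dist v x}

/-- The sum of `numFar G v j` over all `j ≥ k`, written as a sum over vertices: a vertex at
distance `d` contributes `d + 1 - k` if `d ≥ k` and nothing otherwise. -/
noncomputable def farSum (G : SimpleGraph V) (v : V) (k : ℕ) : ℕ :=
  ∑ x, (G.dist v x + 1 - k)

theorem farSum_one (G : SimpleGraph V) (v : V) : G.farSum v 1 = G.transmission v := rfl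

theorem farSum_eq_add (G : SimpleGraph V) (v : V) (k : ℕ) :
    G.farSum v k = G.numFar v k + G.farSum v (k + 1) := by
  unfold farSum numFar
  rw [card_filter, ← sum_add_distrib]
  refine sum_congr rfl fun x _ => ?_
  split_ifs <;> omega

theorem farSum_eq_zero {G : SimpleGraph V} {v : V} {k : ℕ} (h : G.numFar v k = 0) :
    G.farSum v k = 0 := by
  unfold numFar at h
  rw [card_eq_zero, filter_eq_empty_iff] at h
  refine sum_eq_zero fun x hx => ?_
  have := h hx
  omega

theorem Connected.exists_dist_eq {G : SimpleGraph V} (hG : G.Connected) {v : V} {k : ℕ}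
    (h : 0 < G.numFar v k) : ∃ x, G.dist v x = k := by
  obtain ⟨x, hx⟩ := card_pos.1 h
  replace hx := (mem_filter.1 hx).2
  have key : ∀ n x, G.dist v x = k + n → ∃ x, G.dist v x = k := by
    intro n
    induction n with
    | zero => exact fun x hx => ⟨x, hx⟩
    | succ n ih =>
      intro x hx
      obtain ⟨y, -, hy⟩ := hG.exists_adj_dist_succ (v := v) (x := x)
        (by rintro rfl; rw [dist_self] at hx; omega)
      exact ih y (by omega)
  exact key (G.dist v x - k) x (by omega)

theorem numFar_eq_add (G : SimpleGraph V) (v : V) (k : ℕ) :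
    G.numFar v k = #{x | G.dist v x = k} + G.numFar v (k + 1) := by
  unfold numFar
  rw [← card_union_of_disjoint]
  · congr 1
    ext x
    simp only [mem_filter, mem_univ, true_and, mem_union]
    omega
  · rw [disjoint_filter]
    intro x _ h1 h2
    omega

theorem Connected.numFar_succ_lt {G : SimpleGraph V} (hG : G.Connected) {v : V} {k : ℕ}
    (h : 0 < G.numFar v k) : G.numFar v (k + 1) < G.numFar v k := by
  obtain ⟨x, hx⟩ := hG.exists_dist_eq h
  have : 0 < #{x | G.dist v x = k} := card_pos.2 ⟨x, by simpa using hx⟩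
  rw [numFar_eq_add G v k]
  omega

theorem Connected.two_mul_farSum_le {G : SimpleGraph V} (hG : G.Connected) {v : V} {k t : ℕ}
    (h : G.numFar v k ≤ t) : 2 * G.farSum v k ≤ t * (t + 1) := by
  induction t generalizing k with
  | zero => rw [farSum_eq_zero (by omega)]
  | succ t ih =>
    rcases Nat.eq_zero_or_pos (G.numFar v k) with h0 | h0
    · rw [farSum_eq_zero h0]
      omega
    · have h1 := hG.numFar_succ_lt h0
      have h2 := ih (k := k + 1) (by omega)
      rw [farSum_eq_add]
      nlinarith

/-- Without pendant vertices the last two distance levels cannot both be singletons, which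
improves the bound of `Connected.two_mul_farSum_le`. -/
theorem Connected.two_mul_farSum_add_two_le {G : SimpleGraph V} (hG : G.Connected)
    (hdeg : ∀ x, ∃ a b, a ≠ b ∧ G.Adj x a ∧ G.Adj x b) {v : V} {k t : ℕ} (ht : 2 ≤ t)
    (h : G.numFar v k ≤ t) : 2 * G.farSum v k + 2 ≤ t * (t + 1) := by
  induction t, ht using Nat.le_induction generalizing k with
  | base =>
    by_contra! hlt
    have hk := farSum_eq_add G v k
    have hk1 := farSum_eq_add G v (k + 1)
    have hpos : 0 < G.numFar v k := by
      by_contra! h0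
      have := farSum_eq_zero (by omega : G.numFar v k = 0)
      omega
    have h1 := hG.numFar_succ_lt hpos
    have hpos1 : 0 < G.numFar v (k + 1) := by
      by_contra! h0
      have := farSum_eq_zero (by omega : G.numFar v (k + 1) = 0)
      omega
    have h2 := hG.numFar_succ_lt hpos1
    -- now the levels `k` and `k + 1` are singletons and there is nothing beyond
    obtain ⟨x, hx⟩ := hG.exists_dist_eq hpos1
    obtain ⟨a, b, hab, hxa, hxb⟩ := hdeg x
    have hx1 : #{x | G.dist v x = k} ≤ 1 := by
      have := numFar_eq_add G v k
      omega
    have hx2 : #{x | G.dist v x = k + 1} ≤ 1 := by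
      have := numFar_eq_add G v (k + 1)
      omega
    have hmax : ∀ y, G.dist v y < k + 2 := by
      intro y
      by_contra! hy
      have : 0 < G.numFar v (k + 1 + 1) := card_pos.2 ⟨y, mem_filter.2 ⟨mem_univ y, hy⟩⟩
      omega
    have hlev : ∀ y, G.Adj x y → G.dist v y = k := by
      intro y hy
      have h3 := hG.dist_le_succ_of_adj (v := v) hy.symm
      have h4 := hmax y
      by_contra hne
      exact hy.ne (card_le_one.1 hx2 x (by simpa using hx) y (by simp; omega))
    exact hab (card_le_one.1 hx1 a (by simpa using hlev a hxa) b (by simpa using hlev b hxb))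
  | succ t ht ih =>
    rcases Nat.eq_zero_or_pos (G.numFar v k) with h0 | h0
    · rw [farSum_eq_zero h0]
      nlinarith
    · have h1 := hG.numFar_succ_lt h0
      have h2 := ih (k := k + 1) (by omega)
      rw [farSum_eq_add]
      nlinarith

theorem Connected.numFar_one {G : SimpleGraph V} (hG : G.Connected) (v : V) :
    G.numFar v 1 + 1 = Fintype.card V := by
  have h : G.numFar v 0 = _ + G.numFar v 1 := numFar_eq_add G v 0
  have h1 : G.numFar v 0 = Fintype.card V := by simp [numFar, card_univ]
  have h2 : #{x | G.dist v x = 0} = 1 := by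
    rw [card_eq_one]
    refine ⟨v, ?_⟩
    ext x
    simp [hG.dist_eq_zero_iff, eq_comm]
  omega

theorem card_dist_eq_one (G : SimpleGraph V) (v : V) :
    #{x | G.dist v x = 1} = (G.neighborSet v).ncard := by
  rw [← Set.ncard_coe_finset]
  congr 1
  ext x
  simp [dist_eq_one_iff_adj]

theorem Connected.two_mul_transmission_le {G : SimpleGraph V} (hG : G.Connected) (v : V) {m : ℕ}
    (hm : Fintype.card V = m + 1) : 2 * G.transmission v ≤ m * (m + 1) := by
  have := hG.numFar_one v
  rw [← farSum_one]
  exact hG.two_mul_farSum_le (by omega)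

theorem two_le_ncard_of_adj {G : SimpleGraph V} {v a b : V} (hab : a ≠ b) (ha : G.Adj v a)
    (hb : G.Adj v b) : 2 ≤ (G.neighborSet v).ncard := by
  rw [← Set.ncard_pair hab]
  refine Set.ncard_le_ncard ?_ (Set.toFinite _)
  rintro x (rfl | rfl)
  exacts [ha, hb]

theorem transmission_eq_add (G : SimpleGraph V) (v : V) :
    G.transmission v = G.numFar v 1 + (G.numFar v 2 + G.farSum v 3) := by
  rw [← farSum_one, farSum_eq_add, farSum_eq_add]

/-- A vertex with at least two neighbours in a graph with `m + 3` vertices has transmission at most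
`1 + (1 + 2 + ⋯ + (m + 1))`. -/
theorem Connected.two_mul_transmission_le_of_two_le {G : SimpleGraph V} (hG : G.Connected) {v : V}
    (hv : 2 ≤ (G.neighborSet v).ncard) {m : ℕ} (hm : Fintype.card V = m + 3) :
    2 * G.transmission v ≤ m * (m + 1) + 2 * (m + 2) := by
  have h1 := hG.numFar_one v
  have h2 : G.numFar v 1 = _ + G.numFar v 2 := numFar_eq_add G v 1
  rw [card_dist_eq_one] at h2
  have h3 := hG.two_mul_farSum_le (v := v) (k := 2) (t := m) (by omega)
  have h4 : G.farSum v 1 = _ + G.farSum v 2 := farSum_eq_add G v 1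
  rw [← farSum_one]
  omega

theorem Connected.two_mul_transmission_le_of_no_pendant {G : SimpleGraph V} (hG : G.Connected)
    (hdeg : ∀ x, ∃ a b, a ≠ b ∧ G.Adj x a ∧ G.Adj x b) (v : V) {m : ℕ} (hm2 : 2 ≤ m)
    (hm : Fintype.card V = m + 3) :
    2 * G.transmission v ≤ m * (m + 1) + 2 * (m + 1) := by
  have h1 := hG.numFar_one v
  have h2 : G.numFar v 1 = _ + G.numFar v 2 := numFar_eq_add G v 1
  rw [card_dist_eq_one] at h2
  obtain ⟨a, b, hab, ha, hb⟩ := hdeg v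
  have hv := two_le_ncard_of_adj hab ha hb
  have h3 := hG.two_mul_farSum_add_two_le hdeg (v := v) (k := 2) hm2 (by omega)
  have h4 : G.farSum v 1 = _ + G.farSum v 2 := farSum_eq_add G v 1
  rw [← farSum_one]
  omega

/-- The bound of `two_mul_transmission_le_of_two_le`, sharpened for a vertex `v` having also two
vertices `x`, `y` at distance two. -/
theorem Connected.two_mul_transmission_le_of_dist_two {G : SimpleGraph V} (hG : G.Connected)
    {v x y : V} (hv : 2 ≤ (G.neighborSet v).ncard) (hxy : x ≠ y) (hx : G.dist v x = 2)
    (hy : G.dist v y = 2) {m : ℕ} (hm : Fintype.card V = m + 5) :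
    G.numFar v 3 ≤ m ∧ G.transmission v ≤ 2 * m + 6 + G.farSum v 3 := by
  have h1 := hG.numFar_one v
  have h2 : G.numFar v 1 = _ + G.numFar v 2 := numFar_eq_add G v 1
  rw [card_dist_eq_one] at h2
  have h3 : G.numFar v 2 = _ + G.numFar v 3 := numFar_eq_add G v 2
  have h4 : 2 ≤ #{x | G.dist v x = 2} := by
    refine (card_pair hxy).symm.le.trans (card_le_card fun z hz => ?_)
    rcases mem_insert.1 hz with rfl | hz
    · simpa using hx
    · rw [mem_singleton.1 hz]
      simpa using hy
  rw [transmission_eq_add]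
  omega

end SimpleGraph

namespace SimpleGraph

/-! ### The Wiener index of connected graphs and of graphs containing a cycle -/

open scoped Classical

theorem Connected.exists_induce_compl {V : Type*} [Fintype V] {G : SimpleGraph V}
    (hG : G.Connected) (hn : 2 ≤ Fintype.card V) : ∃ v, (G.induce {v}ᶜ).Connected := by
  obtain ⟨s⟩ := hG.nonempty
  obtain ⟨v, hsv, hv⟩ := hG.exists_farthest_ne hn s
  exact ⟨v, hG.induce_compl_of_farthest hsv hv⟩

/-- A connected graph has Wiener index at most that of the path of the same order. -/
theorem Connected.six_mul_wienerIndex_le (m : ℕ) : ∀ {V : Type*} [Fintype V] {G : SimpleGraph V},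
    G.Connected → Fintype.card V = m + 1 → 6 * wienerIndex G ≤ m * (m + 1) * (m + 2) := by
  induction m with
  | zero =>
    intro V _ G hG hV
    have h := two_mul_wienerIndex G
    have : ∀ v, G.transmission v = 0 := fun v => by
      have := hG.two_mul_transmission_le v (m := 0) hV
      omega
    simp only [this, Finset.sum_const_zero] at h
    omega
  | succ m ih =>
    intro V _ G hG hV
    obtain ⟨v, hv⟩ := hG.exists_induce_compl (by omega)
    have h1 := wienerIndex_le_induce_add hv
    have hc := card_compl_singleton_add_one v
    have h2 := ih hv (by omega)
    have h3 := hG.two_mul_transmission_le v hV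
    nlinarith

theorem three_le_card_of_card_le {V : Type*} [Fintype V] [Nonempty V] {G : SimpleGraph V}
    (h : Fintype.card V ≤ G.edgeSet.ncard) : 3 ≤ Fintype.card V := by
  have h1 := G.card_edgeFinset_le_card_choose_two
  rw [← Set.ncard_coe_finset, coe_edgeFinset] at h1
  have h2 : 0 < Fintype.card V := Fintype.card_pos
  by_contra! h3
  have h4 : Fintype.card V = 1 ∨ Fintype.card V = 2 := by omega
  rcases h4 with h4 | h4 <;> rw [Nat.choose_two_right, h4] at h1 <;> omega

theorem Connected.two_mul_transmission_le_of_card_le (m : ℕ) :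
    ∀ {V : Type*} [Fintype V] {G : SimpleGraph V} (v : V), G.Connected → Fintype.card V = m + 1 →
      Fintype.card V ≤ G.edgeSet.ncard → 2 * G.transmission v + m + 3 ≤ (m + 1) ^ 2 := by
  induction m with
  | zero =>
    intro V _ G v hG hV he
    have := hG.nonempty
    have := three_le_card_of_card_le he
    omega
  | succ m ih =>
    intro V _ G v hG hV he
    have := hG.nonempty
    have h3 := three_le_card_of_card_le he
    have hc := card_compl_singleton_add_one v
    have hed := ncard_edgeSet_eq_add G v
    rcases hG.pendant_or_two_neighbors (by omega) v with ⟨u, hu⟩ | ⟨a, b, hab, ha, hb⟩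
    · rw [ncard_neighborSet_of_pendant hu] at hed
      have h2 := ih ⟨u, ((hu u).2 rfl).ne'⟩ (hG.induce_compl_of_pendant hu) (by omega) (by omega)
      have h4 := transmission_of_pendant hG hu
      nlinarith
    · obtain ⟨k, rfl⟩ : ∃ k, m = k + 1 := ⟨m - 1, by omega⟩
      have h4 := hG.two_mul_transmission_le_of_two_le (two_le_ncard_of_adj hab ha hb) (m := k) hV
      nlinarith

/-- A connected graph with at least as many edges as vertices has Wiener index at most that of
a triangle with a pendant path. -/
theorem Connected.six_mul_wienerIndex_le_of_card_le (m : ℕ) :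
    ∀ {V : Type*} [Fintype V] {G : SimpleGraph V}, G.Connected → Fintype.card V = m + 1 →
      Fintype.card V ≤ G.edgeSet.ncard →
      6 * wienerIndex G + 7 * (m + 1) ≤ (m + 1) ^ 3 + 12 := by
  induction m with
  | zero =>
    intro V _ G hG hV he
    have := hG.nonempty
    have := three_le_card_of_card_le he
    omega
  | succ m ih =>
    intro V _ G hG hV he
    obtain ⟨v, hv⟩ := hG.exists_induce_compl (by omega)
    have h1 := wienerIndex_le_induce_add hv
    have hc := card_compl_singleton_add_one v
    have hed := ncard_edgeSet_eq_add G v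
    rcases hG.pendant_or_two_neighbors (by omega) v with ⟨u, hu⟩ | ⟨a, b, hab, ha, hb⟩
    · rw [ncard_neighborSet_of_pendant hu] at hed
      have h2 := ih hv (by omega) (by omega)
      have h3 := hG.two_mul_transmission_le_of_card_le (m + 1) v hV he
      nlinarith
    · have h2 := two_le_ncard_of_adj hab ha hb
      have := hG.nonempty
      have h3 := three_le_card_of_card_le he
      obtain ⟨k, rfl⟩ : ∃ k, m = k + 1 := ⟨m - 1, by omega⟩
      have h4 := hG.two_mul_transmission_le_of_two_le h2 (m := k) hV
      have h5 := hv.six_mul_wienerIndex_le (k + 1) (by omega)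
      nlinarith

end SimpleGraph

namespace SimpleGraph

/-! ### Distances in the named graphs -/

open Finset

/-- Position of the vertex `i` of `graphB n s` along the diametral path through `s + 1`. -/
def posB (s i : ℕ) : ℕ := if i ≤ s + 1 then i else i - 1

/-- The distance between the vertices `i` and `j` of `graphB n s`. -/
def distB (s i j : ℕ) : ℕ :=
  if i = j then 0 else if posB s i = posB s j then 1
  else (posB s i - posB s j) + (posB s j - posB s i)

theorem posB_spec (s i : ℕ) : i ≤ s + 1 ∧ posB s i = i ∨ s + 2 ≤ i ∧ posB s i + 1 = i := by
  unfold posB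
  split_ifs <;> omega

theorem distB_spec (s i j : ℕ) : i = j ∧ distB s i j = 0 ∨
    i ≠ j ∧ posB s i = posB s j ∧ distB s i j = 1 ∨
    posB s i < posB s j ∧ posB s i + distB s i j = posB s j ∨
    posB s j < posB s i ∧ posB s j + distB s i j = posB s i := by
  unfold distB
  split_ifs <;> omega

theorem distB_of_lt {s i j : ℕ} (h : s + 3 ≤ j) (hij : i < j) : distB s i j = j - 1 - posB s i := by
  have h1 := posB_spec s i
  have h2 := posB_spec s j
  have h3 := distB_spec s i j
  omega

theorem distB_comm (s i j : ℕ) : distB s i j = distB s j i := by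
  have h1 := posB_spec s i
  have h2 := posB_spec s j
  have h3 := distB_spec s i j
  have h4 := distB_spec s j i
  omega

theorem graphB_adj {n s : ℕ} (i j : Fin n) : (graphB n s).Adj i j ↔ i.val ≠ j.val ∧
    (((i.val < j.val ∧ s ≤ i.val ∧ j.val ≤ s + 3 ∧ ¬ (i.val = s ∧ j.val = s + 3)) ∨
      (j.val = i.val + 1 ∧ (j.val ≤ s ∨ s + 3 ≤ i.val))) ∨
    ((j.val < i.val ∧ s ≤ j.val ∧ i.val ≤ s + 3 ∧ ¬ (j.val = s ∧ i.val = s + 3)) ∨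
      (i.val = j.val + 1 ∧ (i.val ≤ s ∨ s + 3 ≤ j.val)))) := by
  rw [graphB, fromRel_adj, Ne, Fin.ext_iff]

theorem reachable_and_dist_graphB {n s : ℕ} (i j : Fin n) :
    (graphB n s).Reachable i j ∧ (graphB n s).dist i j = distB s i j := by
  refine dist_eq_of_level (fun j : Fin n => distB s i j) i (by simp [distB]) ?_ ?_ j
  · intro u v h
    rw [graphB_adj] at h
    have h1 := posB_spec s i
    have h2 := posB_spec s u
    have h3 := posB_spec s v
    have h4 := distB_spec s i u
    have h5 := distB_spec s i v
    generalize distB s i u = x at *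
    generalize distB s i v = y at *
    generalize posB s i = p at *
    generalize posB s u = q at *
    generalize posB s v = r at *
    omega
  · intro v hv
    have hv' : i.val ≠ v.val := fun h => hv (Fin.ext h.symm)
    have hi := i.isLt
    have hvn := v.isLt
    suffices ∃ u, ∃ hu : u < n, (graphB n s).Adj ⟨u, hu⟩ v ∧ distB s i u + 1 = distB s i v by
      obtain ⟨u, hu, h⟩ := this
      exact ⟨⟨u, hu⟩, h⟩
    simp only [graphB_adj]
    have h1 := posB_spec s i
    have h3 := posB_spec s v
    have h5 := distB_spec s i v
    by_cases hadj : posB s i = posB s v ∨ distB s i v = 1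
    · refine ⟨i, hi, ?_⟩
      have h4 := distB_spec s i i
      omega
    · by_cases hlt : posB s i < posB s v
      · refine ⟨if v.val = s + 2 then s else v - 1, by split_ifs <;> omega, ?_⟩
        split_ifs with hc
        · have h6 := posB_spec s s
          have h7 := distB_spec s i s
          omega
        · have h6 := posB_spec s (v - 1)
          have h7 := distB_spec s i (v - 1)
          omega
      · refine ⟨if v.val = s + 1 then s + 3 else v + 1, by split_ifs <;> omega, ?_⟩
        split_ifs with hc
        · have h6 := posB_spec s (s + 3)
          have h7 := distB_spec s i (s + 3)
          omega
        · have h6 := posB_spec s (v + 1)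
          have h7 := distB_spec s i (v + 1)
          omega

theorem graphBOne_adj {n : ℕ} (i j : Fin n) : (graphBOne n).Adj i j ↔ i.val ≠ j.val ∧
    (((i.val < j.val ∧ j.val ≤ 3 ∧ ¬ (i.val = 0 ∧ j.val = 1)) ∨
      (3 ≤ i.val ∧ j.val = i.val + 1)) ∨
    ((j.val < i.val ∧ i.val ≤ 3 ∧ ¬ (j.val = 0 ∧ i.val = 1)) ∨
      (3 ≤ j.val ∧ i.val = j.val + 1))) := by
  rw [graphBOne, fromRel_adj, Ne, Fin.ext_iff]

/-- The distance between the vertices `i` and `j` of `graphBOne n`; the truncated subtraction puts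
the vertices `0`, `1`, `2` at the same position. -/
def distBOne (i j : ℕ) : ℕ :=
  if i = j then 0 else if i + j = 1 then 2 else if i - 2 = j - 2 then 1
  else ((i - 2) - (j - 2)) + ((j - 2) - (i - 2))

theorem distBOne_spec (i j : ℕ) : i = j ∧ distBOne i j = 0 ∨
    i + j = 1 ∧ distBOne i j = 2 ∨
    i ≠ j ∧ i + j ≠ 1 ∧ i - 2 = j - 2 ∧ distBOne i j = 1 ∨
    i - 2 < j - 2 ∧ i - 2 + distBOne i j = j - 2 ∨
    j - 2 < i - 2 ∧ j - 2 + distBOne i j = i - 2 := by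
  unfold distBOne
  split_ifs <;> omega

theorem distBOne_of_lt {i j : ℕ} (h : 3 ≤ j) (hij : i < j) :
    distBOne i j = j - 2 - (i - 2) := by
  have h3 := distBOne_spec i j
  omega

theorem distBOne_comm (i j : ℕ) : distBOne i j = distBOne j i := by
  have h3 := distBOne_spec i j
  have h4 := distBOne_spec j i
  omega

theorem reachable_and_dist_graphBOne {n : ℕ} (hn : 4 ≤ n) (i j : Fin n) :
    (graphBOne n).Reachable i j ∧ (graphBOne n).dist i j = distBOne i j := by
  refine dist_eq_of_level (fun j : Fin n => distBOne i j) i (by simp [distBOne]) ?_ ?_ j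
  · intro u v h
    rw [graphBOne_adj] at h
    have h4 := distBOne_spec i u
    have h5 := distBOne_spec i v
    generalize distBOne i u = x at *
    generalize distBOne i v = y at *
    omega
  · intro v hv
    have hv' : i.val ≠ v.val := fun h => hv (Fin.ext h.symm)
    have hi := i.isLt
    have hvn := v.isLt
    suffices ∃ u, ∃ hu : u < n, (graphBOne n).Adj ⟨u, hu⟩ v ∧ distBOne i u + 1 = distBOne i v by
      obtain ⟨u, hu, h⟩ := this
      exact ⟨⟨u, hu⟩, h⟩
    simp only [graphBOne_adj]
    have h5 := distBOne_spec i v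
    by_cases hadj : distBOne i v = 1
    · refine ⟨i, hi, ?_⟩
      have h4 := distBOne_spec i i
      omega
    · by_cases hlt : i.val ≤ v.val ∧ 3 ≤ v.val
      · refine ⟨v - 1, by omega, ?_⟩
        have h7 := distBOne_spec i (v - 1)
        omega
      · refine ⟨if v.val ≤ 2 then 3 else v + 1, by split_ifs <;> omega, ?_⟩
        split_ifs with hc
        · have h7 := distBOne_spec i 3
          omega
        · have h7 := distBOne_spec i (v + 1)
          omega

theorem graphBCycles_adj {n : ℕ} (i j : Fin n) : (graphBCycles n 3 3).Adj i j ↔ i.val ≠ j.val ∧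
    ((j.val = i.val + 1 ∨ (i.val = 0 ∧ j.val + 1 = 3) ∨ (i.val + 3 = n ∧ j.val + 1 = n)) ∨
     (i.val = j.val + 1 ∨ (j.val = 0 ∧ i.val + 1 = 3) ∨ (j.val + 3 = n ∧ i.val + 1 = n))) := by
  rw [graphBCycles, fromRel_adj, Ne, Fin.ext_iff]

/-- Position of the vertex `i` of `graphBCycles n 3 3` along the diametral path through `0`
and `n - 2`. -/
def posCycles (n i : ℕ) : ℕ := min (i - 1) (n - 3)

/-- The distance between the vertices `i` and `j` of `graphBCycles n 3 3`. -/
def distCycles (n i j : ℕ) : ℕ :=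
  if i = j then 0 else if posCycles n i = posCycles n j then 1
  else (posCycles n i - posCycles n j) + (posCycles n j - posCycles n i)

theorem distCycles_spec (n i j : ℕ) : i = j ∧ distCycles n i j = 0 ∨
    i ≠ j ∧ posCycles n i = posCycles n j ∧ distCycles n i j = 1 ∨
    posCycles n i < posCycles n j ∧ posCycles n i + distCycles n i j = posCycles n j ∨
    posCycles n j < posCycles n i ∧ posCycles n j + distCycles n i j = posCycles n i := by
  unfold distCycles
  split_ifs <;> omega

theorem distCycles_comm (n i j : ℕ) : distCycles n i j = distCycles n j i := by
  unfold distCycles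
  split_ifs <;> omega

theorem reachable_and_dist_graphBCycles {n : ℕ} (hn : 5 ≤ n) (i j : Fin n) :
    (graphBCycles n 3 3).Reachable i j ∧ (graphBCycles n 3 3).dist i j = distCycles n i j := by
  have hpos : ∀ i, posCycles n i = min (i - 1) (n - 3) := fun _ => rfl
  refine dist_eq_of_level (fun j : Fin n => distCycles n i j) i (by simp [distCycles]) ?_ ?_ j
  · intro u v h
    rw [graphBCycles_adj] at h
    have h4 := distCycles_spec n i u
    have h5 := distCycles_spec n i v
    have hi := i.isLt
    have hu := u.isLt
    have hv := v.isLt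
    rw [hpos, hpos] at h4 h5
    generalize distCycles n i u = x at *
    generalize distCycles n i v = y at *
    omega
  · intro v hv
    have hv' : i.val ≠ v.val := fun h => hv (Fin.ext h.symm)
    have hi := i.isLt
    have hvn := v.isLt
    suffices ∃ u, ∃ hu : u < n, (graphBCycles n 3 3).Adj ⟨u, hu⟩ v ∧
        distCycles n i u + 1 = distCycles n i v by
      obtain ⟨u, hu, h⟩ := this
      exact ⟨⟨u, hu⟩, h⟩
    simp only [graphBCycles_adj]
    have h5 := distCycles_spec n i v
    rw [hpos, hpos] at h5
    by_cases hadj : distCycles n i v = 1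
    · refine ⟨i, hi, ?_⟩
      have h4 := distCycles_spec n i i
      rw [hpos] at h4
      omega
    · by_cases hlt : i.val < v.val
      · refine ⟨if v.val + 1 = n then n - 3 else v - 1, by split_ifs <;> omega, ?_⟩
        split_ifs with hc
        · have h7 := distCycles_spec n i (n - 3)
          rw [hpos, hpos] at h7
          omega
        · have h7 := distCycles_spec n i (v - 1)
          rw [hpos, hpos] at h7
          omega
      · refine ⟨if v.val = 0 then 2 else v + 1, by split_ifs <;> omega, ?_⟩
        split_ifs with hc
        · have h7 := distCycles_spec n i 2
          rw [hpos, hpos] at h7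
          omega
        · have h7 := distCycles_spec n i (v + 1)
          rw [hpos, hpos] at h7
          omega

end SimpleGraph

namespace SimpleGraph

/-! ### Wiener indices and edge numbers of the named graphs -/

open Finset

theorem sum_range_sum_range_of_symm (d : ℕ → ℕ → ℕ) (h0 : ∀ i, d i i = 0)
    (hs : ∀ i j, d i j = d j i) (n : ℕ) :
    ∑ i ∈ range n, ∑ j ∈ range n, d i j = 2 * ∑ j ∈ range n, ∑ i ∈ range j, d i j := by
  induction n with
  | zero => simp
  | succ n ih =>
    simp only [sum_range_succ, sum_add_distrib, h0, fun i => hs n i, mul_add, ih]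
    ring

section

variable {n : ℕ} {G : SimpleGraph (Fin n)} {d : ℕ → ℕ → ℕ}

theorem transmission_eq_sum_range (hd : ∀ i j : Fin n, G.dist i j = d i j) (u : Fin n) :
    G.transmission u = ∑ j ∈ range n, d u j := by
  rw [transmission, sum_range]
  exact sum_congr rfl fun j _ => hd u j

theorem wienerIndex_eq_sum_range (hd : ∀ i j : Fin n, G.dist i j = d i j) (h0 : ∀ i, d i i = 0)
    (hs : ∀ i j, d i j = d j i) :
    wienerIndex G = ∑ j ∈ range n, ∑ i ∈ range j, d i j := by
  have h1 := two_mul_wienerIndex G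
  simp only [transmission_eq_sum_range hd] at h1
  rw [← sum_range fun i => ∑ j ∈ range n, d i j, sum_range_sum_range_of_symm d h0 hs] at h1
  omega

theorem ncard_edgeSet_eq_sum_range (hd : ∀ i j : Fin n, G.dist i j = d i j) (h0 : ∀ i, d i i = 0)
    (hs : ∀ i j, d i j = d j i) :
    G.edgeSet.ncard = ∑ j ∈ range n, ∑ i ∈ range j, if d i j = 1 then 1 else 0 := by
  classical
  have h1 := sum_ncard_neighborSet G
  have h2 : ∀ u, (G.neighborSet u).ncard = ∑ j ∈ range n, if d u j = 1 then 1 else 0 := by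
    intro u
    rw [← card_dist_eq_one, card_filter, sum_range]
    exact sum_congr rfl fun j _ => by rw [hd]
  simp only [h2] at h1
  rw [← sum_range fun i => ∑ j ∈ range n, if d i j = 1 then 1 else 0,
    sum_range_sum_range_of_symm (fun i j => if d i j = 1 then 1 else 0) (by simp [h0])
      (fun i j => by simp only [hs i j])] at h1
  omega

end

theorem distB_self (s i : ℕ) : distB s i i = 0 := by simp [distB]

theorem distBOne_self (i : ℕ) : distBOne i i = 0 := by simp [distBOne]

theorem distCycles_self (n i : ℕ) : distCycles n i i = 0 := by simp [distCycles]

theorem sum_distB_succ (s j : ℕ) (hj : s + 3 ≤ j) :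
    ∑ i ∈ range (j + 1), distB s i (j + 1) = ∑ i ∈ range j, distB s i j + (j + 1) := by
  have h : ∀ i ∈ range j, distB s i (j + 1) = distB s i j + 1 := by
    intro i hi
    rw [mem_range] at hi
    rw [distB_of_lt (by omega) (by omega), distB_of_lt (by omega) hi]
    have := posB_spec s i
    omega
  have h1 : distB s j (j + 1) = 1 := by
    rw [distB_of_lt (by omega) (by omega)]
    have := posB_spec s j
    omega
  rw [sum_range_succ, sum_congr rfl h, sum_add_distrib, h1]
  simp
  omega

theorem sum_distB_eq_one (s j : ℕ) (hj : s + 4 ≤ j) :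
    ∑ i ∈ range j, (if distB s i j = 1 then 1 else 0) = 1 := by
  rw [sum_eq_single (j - 1)]
  · rw [if_pos]
    rw [distB_of_lt (by omega) (by omega)]
    have := posB_spec s (j - 1)
    omega
  · intro i hi hne
    rw [mem_range] at hi
    rw [if_neg]
    rw [distB_of_lt (by omega) hi]
    have := posB_spec s i
    omega
  · intro h
    rw [mem_range] at h
    omega

theorem sum_distBOne_succ (j : ℕ) (hj : 3 ≤ j) :
    ∑ i ∈ range (j + 1), distBOne i (j + 1) = ∑ i ∈ range j, distBOne i j + (j + 1) := by
  have h : ∀ i ∈ range j, distBOne i (j + 1) = distBOne i j + 1 := by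
    intro i hi
    rw [mem_range] at hi
    rw [distBOne_of_lt (by omega) (by omega), distBOne_of_lt (by omega) hi]
    omega
  have h1 : distBOne j (j + 1) = 1 := by
    rw [distBOne_of_lt (by omega) (by omega)]
    omega
  rw [sum_range_succ, sum_congr rfl h, sum_add_distrib, h1]
  simp
  omega

theorem sum_distBOne_eq_one (j : ℕ) (hj : 4 ≤ j) :
    ∑ i ∈ range j, (if distBOne i j = 1 then 1 else 0) = 1 := by
  rw [sum_eq_single (j - 1)]
  · rw [if_pos]
    rw [distBOne_of_lt (by omega) (by omega)]
    omega
  · intro i hi hne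
    rw [mem_range] at hi
    rw [if_neg]
    rw [distBOne_of_lt (by omega) hi]
    omega
  · intro h
    rw [mem_range] at h
    omega

theorem ncard_edgeSet_graphB {s : ℕ} (hs : s ≤ 2) (k : ℕ) :
    (graphB (s + 4 + k) s).edgeSet.ncard = s + 4 + k + 1 := by
  rw [ncard_edgeSet_eq_sum_range (fun i j => (reachable_and_dist_graphB i j).2) (distB_self s)
    (distB_comm s)]
  induction k with
  | zero => interval_cases s <;> decide
  | succ k ih => rw [← add_assoc, sum_range_succ, ih, sum_distB_eq_one s _ (by omega)]

theorem isBicyclic_graphB {n s : ℕ} (hs : s ≤ 2) (hn : s + 4 ≤ n) : IsBicyclic (graphB n s) := by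
  obtain ⟨k, rfl⟩ := Nat.exists_eq_add_of_le hn
  refine ⟨(connected_iff _).2 ⟨fun i j => (reachable_and_dist_graphB i j).1, ⟨⟨0, by omega⟩⟩⟩, ?_⟩
  rw [ncard_edgeSet_graphB hs, Fintype.card_fin]

theorem isBicyclic_graphBOne {n : ℕ} (hn : 4 ≤ n) : IsBicyclic (graphBOne n) := by
  refine ⟨(connected_iff _).2 ⟨fun i j => (reachable_and_dist_graphBOne hn i j).1,
    ⟨⟨0, by omega⟩⟩⟩, ?_⟩
  rw [Fintype.card_fin, ncard_edgeSet_eq_sum_range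
    (fun i j => (reachable_and_dist_graphBOne hn i j).2) distBOne_self distBOne_comm]
  induction n, hn using Nat.le_induction with
  | base => decide
  | succ n hn ih => rw [sum_range_succ, ih, sum_distBOne_eq_one _ hn]

theorem two_mul_sum_distB_zero (j : ℕ) :
    2 * ∑ i ∈ range (j + 3), distB 0 i (j + 3) + 4 = (j + 3) ^ 2 + (j + 3) := by
  induction j with
  | zero => decide
  | succ j ih =>
    have := sum_distB_succ 0 (j + 3) (by omega)
    rw [show j + 1 + 3 = j + 3 + 1 by ring, this]
    nlinarith

theorem two_mul_sum_distB_one (j : ℕ) :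
    2 * ∑ i ∈ range (j + 4), distB 1 i (j + 4) + 6 = (j + 4) ^ 2 + (j + 4) := by
  induction j with
  | zero => decide
  | succ j ih =>
    have := sum_distB_succ 1 (j + 4) (by omega)
    rw [show j + 1 + 4 = j + 4 + 1 by ring, this]
    nlinarith

theorem two_mul_sum_distBOne (j : ℕ) :
    2 * ∑ i ∈ range (j + 3), distBOne i (j + 3) + 6 = (j + 3) ^ 2 + (j + 3) := by
  induction j with
  | zero => decide
  | succ j ih =>
    have := sum_distBOne_succ (j + 3) (by omega)
    rw [show j + 1 + 3 = j + 3 + 1 by ring, this]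
    nlinarith

theorem wienerIndex_graphB (n s : ℕ) :
    wienerIndex (graphB n s) = ∑ j ∈ range n, ∑ i ∈ range j, distB s i j :=
  wienerIndex_eq_sum_range (fun i j => (reachable_and_dist_graphB i j).2) (distB_self s)
    (distB_comm s)

theorem six_mul_wienerIndex_graphB_zero {n : ℕ} (hn : 4 ≤ n) :
    6 * wienerIndex (graphB n 0) + 13 * n = n ^ 3 + 30 := by
  rw [wienerIndex_graphB]
  induction n, hn using Nat.le_induction with
  | base => decide
  | succ n hn ih =>
    obtain ⟨k, rfl⟩ := Nat.exists_eq_add_of_le' (by omega : 3 ≤ n)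
    have := two_mul_sum_distB_zero k
    rw [sum_range_succ]
    nlinarith

theorem six_mul_wienerIndex_graphB_one {n : ℕ} (hn : 5 ≤ n) :
    6 * wienerIndex (graphB n 1) + 19 * n = n ^ 3 + 60 := by
  rw [wienerIndex_graphB]
  induction n, hn using Nat.le_induction with
  | base => decide
  | succ n hn ih =>
    obtain ⟨k, rfl⟩ := Nat.exists_eq_add_of_le' (by omega : 4 ≤ n)
    have := two_mul_sum_distB_one k
    rw [sum_range_succ]
    nlinarith

theorem wienerIndex_graphB_eight_two : wienerIndex (graphB 8 2) = 69 := by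
  rw [wienerIndex_graphB]
  decide

theorem six_mul_wienerIndex_graphBOne {n : ℕ} (hn : 4 ≤ n) :
    6 * wienerIndex (graphBOne n) + 19 * n = n ^ 3 + 54 := by
  rw [wienerIndex_eq_sum_range (fun i j => (reachable_and_dist_graphBOne hn i j).2) distBOne_self
    distBOne_comm]
  induction n, hn using Nat.le_induction with
  | base => decide
  | succ n hn ih =>
    obtain ⟨k, rfl⟩ := Nat.exists_eq_add_of_le' (by omega : 3 ≤ n)
    have := two_mul_sum_distBOne k
    rw [sum_range_succ]
    nlinarith

/-- Distances in `graphBCycles n 3 3` avoiding the last vertex do not depend on `n`. -/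
theorem distCycles_of_lt {n i j : ℕ} (hij : i < j) (hj : j + 2 ≤ n) :
    distCycles n i j = if i + j = 1 then 1 else (j - 1) - (i - 1) := by
  have h := distCycles_spec n i j
  unfold posCycles at h
  split_ifs <;> omega

theorem sum_ite_succ (j : ℕ) :
    ∑ i ∈ range (j + 3), (if i + (j + 3) = 1 then 1 else (j + 3 - 1) - (i - 1))
      = ∑ i ∈ range (j + 2), (if i + (j + 2) = 1 then 1 else (j + 2 - 1) - (i - 1)) + (j + 3) := by
  rw [sum_range_succ, sum_congr rfl (g := fun i =>
    (if i + (j + 2) = 1 then 1 else (j + 2 - 1) - (i - 1)) + 1), sum_add_distrib]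
  · simp
    omega
  · intro i hi
    rw [mem_range] at hi
    rw [if_neg (by omega), if_neg (by omega)]
    omega

theorem two_mul_sum_ite (j : ℕ) :
    2 * ∑ i ∈ range (j + 2), (if i + (j + 2) = 1 then 1 else (j + 2 - 1) - (i - 1))
      = (j + 1) * (j + 4) := by
  induction j with
  | zero => decide
  | succ j ih =>
    rw [show j + 1 + 2 = j + 3 by ring, sum_ite_succ, mul_add, ih]
    ring

theorem six_mul_sum_sum_ite (k : ℕ) :
    6 * ∑ j ∈ range (k + 2), ∑ i ∈ range j, (if i + j = 1 then 1 else (j - 1) - (i - 1))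
      = k * (k + 1) * (k + 5) + 6 := by
  induction k with
  | zero => decide
  | succ k ih =>
    have := two_mul_sum_ite k
    rw [show k + 1 + 2 = k + 2 + 1 by ring, sum_range_succ, mul_add, ih]
    linarith

theorem six_mul_wienerIndex_graphBCycles {n : ℕ} (hn : 5 ≤ n) :
    6 * wienerIndex (graphBCycles n 3 3) + 13 * n = n ^ 3 + 24 := by
  rw [wienerIndex_eq_sum_range (fun i j => (reachable_and_dist_graphBCycles hn i j).2)
    (distCycles_self n) (distCycles_comm n)]
  obtain ⟨k, rfl⟩ := Nat.exists_eq_add_of_le' hn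
  have h1 : ∑ j ∈ range (k + 4), ∑ i ∈ range j, distCycles (k + 5) i j =
      ∑ j ∈ range (k + 4), ∑ i ∈ range j, (if i + j = 1 then 1 else (j - 1) - (i - 1)) := by
    refine sum_congr rfl fun j hj => sum_congr rfl fun i hi => ?_
    rw [mem_range] at hi hj
    exact distCycles_of_lt hi (by omega)
  have h2 : ∑ i ∈ range (k + 3), distCycles (k + 5) i (k + 4) =
      ∑ i ∈ range (k + 3), (if i + (k + 3) = 1 then 1 else (k + 3 - 1) - (i - 1)) := by
    refine sum_congr rfl fun i hi => ?_
    rw [mem_range] at hi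
    have h := distCycles_spec (k + 5) i (k + 4)
    unfold posCycles at h
    rw [if_neg (by omega)]
    omega
  have h3 : distCycles (k + 5) (k + 3) (k + 4) = 1 := by
    have h := distCycles_spec (k + 5) (k + 3) (k + 4)
    unfold posCycles at h
    omega
  have h4 := six_mul_sum_sum_ite (k + 2)
  have h5 := two_mul_sum_ite (k + 1)
  rw [show k + 5 = k + 4 + 1 by ring, sum_range_succ]
  rw [show k + 4 + 1 = k + 5 by ring, h1, sum_range_succ (fun i => distCycles (k + 5) i (k + 4)), h2, h3]
  rw [show k + 2 + 2 = k + 4 by ring] at h4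
  rw [show k + 1 + 2 = k + 3 by ring] at h5
  nlinarith

theorem sum_ite_eq_one (j : ℕ) : ∑ i ∈ range (j + 3),
    (if (if i + (j + 3) = 1 then 1 else (j + 3 - 1) - (i - 1)) = 1 then 1 else 0) = 1 := by
  rw [sum_eq_single (j + 2)]
  · rw [if_pos]
    rw [if_neg (by omega)]
    omega
  · intro i hi hne
    rw [mem_range] at hi
    rw [if_neg]
    rw [if_neg (by omega)]
    omega
  · simp

theorem isBicyclic_graphBCycles {n : ℕ} (hn : 5 ≤ n) : IsBicyclic (graphBCycles n 3 3) := by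
  refine ⟨(connected_iff _).2 ⟨fun i j => (reachable_and_dist_graphBCycles hn i j).1,
    ⟨⟨0, by omega⟩⟩⟩, ?_⟩
  rw [Fintype.card_fin, ncard_edgeSet_eq_sum_range
    (fun i j => (reachable_and_dist_graphBCycles hn i j).2) (distCycles_self n)
    (distCycles_comm n)]
  obtain ⟨k, rfl⟩ := Nat.exists_eq_add_of_le' hn
  have h1 : ∑ j ∈ range (k + 4), ∑ i ∈ range j, (if distCycles (k + 5) i j = 1 then 1 else 0) =
      k + 4 := by
    have h2 : ∑ j ∈ range (k + 4), ∑ i ∈ range j,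
        (if (if i + j = 1 then 1 else (j - 1) - (i - 1)) = 1 then 1 else 0) = k + 4 := by
      clear hn
      induction k with
      | zero => decide
      | succ k ih =>
        rw [show k + 1 + 4 = k + 4 + 1 by ring, sum_range_succ, ih, sum_ite_eq_one]
    refine Eq.trans ?_ h2
    refine sum_congr rfl fun j hj => sum_congr rfl fun i hi => ?_
    rw [mem_range] at hi hj
    rw [distCycles_of_lt hi (by omega)]
  have h2 : ∑ i ∈ range (k + 4), (if distCycles (k + 5) i (k + 4) = 1 then 1 else 0) = 2 := by
    rw [sum_range_succ, sum_range_succ, sum_eq_zero]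
    · have h := distCycles_spec (k + 5) (k + 3) (k + 4)
      have h' := distCycles_spec (k + 5) (k + 2) (k + 4)
      unfold posCycles at h h'
      rw [if_pos (by omega), if_pos (by omega)]
    · intro i hi
      rw [mem_range] at hi
      have h := distCycles_spec (k + 5) i (k + 4)
      unfold posCycles at h
      rw [if_neg (by omega)]
  rw [show k + 5 = k + 4 + 1 by ring, sum_range_succ]
  rw [show k + 4 + 1 = k + 5 by ring, h1, h2]

end SimpleGraph

namespace SimpleGraph

/-! ### Transmissions in the named graphs -/

open Finset

theorem two_mul_sum_distB_of_le {s u : ℕ} (hu : s + 3 ≤ u) (r : ℕ) :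
    2 * ∑ j ∈ range (u + 1 + r), distB s u j
      = 2 * ∑ i ∈ range u, distB s i u + r * (r + 1) := by
  induction r with
  | zero =>
    rw [add_zero, sum_range_succ, distB_self]
    simp [distB_comm s u]
  | succ r ih =>
    have h : distB s u (u + 1 + r) = r + 1 := by
      rw [distB_of_lt (by omega) (by omega)]
      have := posB_spec s u
      omega
    rw [show u + 1 + (r + 1) = u + 1 + r + 1 by ring, sum_range_succ, mul_add, ih, h]
    ring

theorem two_mul_transmission_graphB_zero_le {m : ℕ} (hm : 5 ≤ m) (u : Fin m) (h1 : 1 ≤ u.val)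
    (h2 : u.val + 2 ≤ m) : 2 * (graphB m 0).transmission u + 3 * m ≤ m ^ 2 := by
  rw [transmission_eq_sum_range fun i j => (reachable_and_dist_graphB i j).2]
  obtain ⟨u, hum⟩ := u
  simp only at h1 h2 ⊢
  clear hum
  by_cases hu : u < 3
  · have key : ∀ k, 2 * ∑ j ∈ range (k + 4), distB 0 u j = k * (k + 3) + 6 := by
      intro k
      induction k with
      | zero => interval_cases u <;> decide
      | succ k ih =>
        have h : distB 0 u (k + 4) = k + 2 := by
          rw [distB_of_lt (by omega) (by omega)]
          have := posB_spec 0 u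
          omega
        rw [show k + 1 + 4 = k + 4 + 1 by ring, sum_range_succ, mul_add, ih, h]
        ring
    obtain ⟨k, rfl⟩ := Nat.exists_eq_add_of_le' hm
    rw [show k + 5 = k + 1 + 4 by ring, key]
    nlinarith
  · obtain ⟨r, rfl⟩ := Nat.exists_eq_add_of_le (h2 : u + 2 ≤ m)
    obtain ⟨u, rfl⟩ := Nat.exists_eq_add_of_le' (by omega : 3 ≤ u)
    rw [show u + 3 + 2 + r = u + 3 + 1 + (r + 1) by ring, two_mul_sum_distB_of_le (by omega)]
    have := two_mul_sum_distB_zero u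
    nlinarith [Nat.zero_le (u * r)]

theorem two_mul_transmission_graphB_one_le {m : ℕ} (hm : 6 ≤ m) (u : Fin m) (h1 : 1 ≤ u.val)
    (h2 : u.val + 2 ≤ m) : 2 * (graphB m 1).transmission u + m + 10 ≤ m ^ 2 := by
  rw [transmission_eq_sum_range fun i j => (reachable_and_dist_graphB i j).2]
  obtain ⟨u, hum⟩ := u
  simp only at h1 h2 ⊢
  clear hum
  by_cases hu : u < 4
  · have key : ∀ k, 2 * ∑ j ∈ range (k + 5), distB 1 u j ≤ k * (k + 5) + 10 := by
      intro k
      induction k with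
      | zero => interval_cases u <;> decide
      | succ k ih =>
        have h : distB 1 u (k + 5) ≤ k + 3 := by
          rw [distB_of_lt (by omega) (by omega)]
          have := posB_spec 1 u
          omega
        rw [show k + 1 + 5 = k + 5 + 1 by ring, sum_range_succ, mul_add]
        nlinarith
    obtain ⟨k, rfl⟩ := Nat.exists_eq_add_of_le' hm
    have := key (k + 1)
    rw [show k + 6 = k + 1 + 5 by ring]
    nlinarith
  · obtain ⟨r, rfl⟩ := Nat.exists_eq_add_of_le (h2 : u + 2 ≤ m)
    obtain ⟨u, rfl⟩ := Nat.exists_eq_add_of_le' (by omega : 4 ≤ u)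
    rw [show u + 4 + 2 + r = u + 4 + 1 + (r + 1) by ring, two_mul_sum_distB_of_le (by omega)]
    have := two_mul_sum_distB_one u
    nlinarith [Nat.zero_le (u * r)]

theorem two_mul_transmission_graphB_one_first {m : ℕ} (hm : 5 ≤ m) (u : Fin m)
    (hu : u.val = 0) : 2 * (graphB m 1).transmission u + 3 * m = m ^ 2 + 6 := by
  rw [transmission_eq_sum_range fun i j => (reachable_and_dist_graphB i j).2, hu]
  obtain ⟨k, rfl⟩ := Nat.exists_eq_add_of_le' hm
  have key : ∀ k, 2 * ∑ j ∈ range (k + 4), distB 1 0 j = k * (k + 5) + 10 := by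
    intro k
    induction k with
    | zero => decide
    | succ k ih =>
      have h : distB 1 0 (k + 4) = k + 3 := by
        rw [distB_of_lt (by omega) (by omega)]
        have := posB_spec 1 0
        omega
      rw [show k + 1 + 4 = k + 4 + 1 by ring, sum_range_succ, mul_add, ih, h]
      ring
  have := key (k + 1)
  rw [show k + 5 = k + 1 + 4 by ring]
  nlinarith

theorem exists_two_neighbors_graphBCycles {m : ℕ} (hm : 5 ≤ m) (u : Fin m) :
    ∃ a b, a ≠ b ∧ (graphBCycles m 3 3).Adj u a ∧ (graphBCycles m 3 3).Adj u b := by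
  have hu := u.isLt
  suffices ∃ a b, ∃ (ha : a < m) (hb : b < m), a ≠ b ∧
      (graphBCycles m 3 3).Adj u ⟨a, ha⟩ ∧ (graphBCycles m 3 3).Adj u ⟨b, hb⟩ by
    obtain ⟨a, b, ha, hb, hab, h1, h2⟩ := this
    exact ⟨⟨a, ha⟩, ⟨b, hb⟩, fun h => hab (Fin.mk.inj h), h1, h2⟩
  simp only [graphBCycles_adj]
  refine ⟨if u.val = 0 then 2 else u.val - 1, if u.val + 1 = m then m - 3 else u.val + 1,
    by split_ifs <;> omega, by split_ifs <;> omega, ?_⟩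
  split_ifs <;> omega

theorem two_mul_transmission_graphBCycles_le {m : ℕ} (hm : 5 ≤ m) (u : Fin m) :
    2 * (graphBCycles m 3 3).transmission u + 3 * m ≤ m ^ 2 + 2 := by
  obtain ⟨k, rfl⟩ := Nat.exists_eq_add_of_le' hm
  have h := (isBicyclic_graphBCycles hm).1.two_mul_transmission_le_of_no_pendant
    (exists_two_neighbors_graphBCycles hm) u (m := k + 2) (by omega) (by simp)
  nlinarith

end SimpleGraph

namespace SimpleGraph

/-! ### Isomorphisms with the named graphs -/

open Finset
open scoped Classical

/-- Adding a pendant vertex on both sides extends an isomorphism. -/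
theorem exists_iso_of_pendant {V : Type*} [Fintype V] {G : SimpleGraph V} {v u : V}
    (h : ∀ x, G.Adj v x ↔ x = u) {m : ℕ} {H : SimpleGraph (Fin m)} {H' : SimpleGraph (Fin (m + 1))}
    (hu : u ∈ ({v}ᶜ : Set V)) (e : G.induce {v}ᶜ ≃g H)
    (h1 : ∀ i j, H'.Adj (Fin.castSucc i) (Fin.castSucc j) ↔ H.Adj i j)
    (h2 : ∀ j, H'.Adj (Fin.last m) (Fin.castSucc j) ↔ j = e ⟨u, hu⟩) :
    ∃ e' : G ≃g H', e' v = Fin.last m := by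
  let f : V → Fin (m + 1) := fun x => if hx : x = v then Fin.last m else (e ⟨x, hx⟩).castSucc
  have hfv : f v = Fin.last m := by simp [f]
  have hf : ∀ x (hx : x ≠ v), f x = (e ⟨x, hx⟩).castSucc := fun x hx => by simp [f, hx]
  have hinj : Function.Injective f := by
    intro x y hxy
    by_cases hx : x = v
    · by_cases hy : y = v
      · rw [hx, hy]
      · rw [hx, hfv, hf y hy] at hxy
        exact absurd hxy.symm (Fin.castSucc_ne_last _)
    · by_cases hy : y = v
      · rw [hy, hfv, hf x hx] at hxy
        exact absurd hxy (Fin.castSucc_ne_last _)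
      · rw [hf x hx, hf y hy] at hxy
        have := e.injective (Fin.castSucc_injective _ hxy)
        exact congrArg Subtype.val this
  have hcard : Fintype.card V = Fintype.card (Fin (m + 1)) := by
    rw [← card_compl_singleton_add_one v, Fintype.card_congr e.toEquiv]
    simp
  have hbij : Function.Bijective f := (Fintype.bijective_iff_injective_and_card f).2 ⟨hinj, hcard⟩
  have hvy : ∀ y, y ≠ v → (H'.Adj (f v) (f y) ↔ G.Adj v y) := by
    intro y hy
    rw [hfv, hf y hy, h2, h, e.injective.eq_iff]
    exact ⟨fun h => congrArg Subtype.val h, fun h => Subtype.ext h⟩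
  refine ⟨⟨Equiv.ofBijective f hbij, ?_⟩, hfv⟩
  intro x y
  change H'.Adj (f x) (f y) ↔ G.Adj x y
  by_cases hx : x = v
  · by_cases hy : y = v
    · simp [hx, hy]
    · rw [hx, hvy y hy]
  · by_cases hy : y = v
    · rw [hy, H'.adj_comm, hvy x hx, G.adj_comm]
    · rw [hf x hx, hf y hy, h1, e.map_adj_iff]
      rfl

/-- The graph `graphB n s` read from right to left. -/
theorem exists_iso_graphB_rev {n s : ℕ} (hn : s + 4 ≤ n) :
    ∃ e : graphB n s ≃g graphB n (n - 4 - s), ∀ i, e i = Fin.rev i := by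
  refine ⟨⟨Fin.revPerm, ?_⟩, fun i => rfl⟩
  intro i j
  have hi := i.isLt
  have hj := j.isLt
  simp only [graphB_adj, Fin.revPerm_apply, Fin.val_rev]
  omega

theorem exists_iso_graphB_of_pendant {V : Type*} [Fintype V] {G : SimpleGraph V} {v u : V}
    (h : ∀ x, G.Adj v x ↔ x = u) {m s : ℕ} (hm : s + 4 ≤ m) (hu : u ∈ ({v}ᶜ : Set V))
    (e : G.induce {v}ᶜ ≃g graphB m s) (he : (e ⟨u, hu⟩).val + 1 = m) :
    ∃ e' : G ≃g graphB (m + 1) s, (e' v).val = m := by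
  obtain ⟨e', he'⟩ := exists_iso_of_pendant h (H' := graphB (m + 1) s) hu e
    (fun i j => by simp only [graphB_adj, Fin.val_castSucc])
    (fun j => by
      have := j.isLt
      rw [graphB_adj, Fin.ext_iff]
      simp only [Fin.val_last, Fin.val_castSucc]
      omega)
  exact ⟨e', by rw [he', Fin.val_last]⟩

theorem exists_iso_graphBOne_of_pendant {V : Type*} [Fintype V] {G : SimpleGraph V} {v u : V}
    (h : ∀ x, G.Adj v x ↔ x = u) {m : ℕ} (hm : 4 ≤ m) (hu : u ∈ ({v}ᶜ : Set V))
    (e : G.induce {v}ᶜ ≃g graphBOne m) (he : (e ⟨u, hu⟩).val + 1 = m) :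
    ∃ e' : G ≃g graphBOne (m + 1), (e' v).val = m := by
  obtain ⟨e', he'⟩ := exists_iso_of_pendant h (H' := graphBOne (m + 1)) hu e
    (fun i j => by simp only [graphBOne_adj, Fin.val_castSucc])
    (fun j => by
      have := j.isLt
      rw [graphBOne_adj, Fin.ext_iff]
      simp only [Fin.val_last, Fin.val_castSucc]
      omega)
  exact ⟨e', by rw [he', Fin.val_last]⟩

/-- A graph obtained from `B(m, s)` by a pendant vertex at the left end is `B(m + 1, s + 1)`. -/
theorem exists_iso_graphB_of_pendant_first {V : Type*} [Fintype V] {G : SimpleGraph V} {v u : V}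
    (h : ∀ x, G.Adj v x ↔ x = u) {m s : ℕ} (hm : s + 4 ≤ m) (hu : u ∈ ({v}ᶜ : Set V))
    (e : G.induce {v}ᶜ ≃g graphB m s) (he : (e ⟨u, hu⟩).val = 0) :
    Nonempty (G ≃g graphB (m + 1) (s + 1)) := by
  obtain ⟨r, hr⟩ := exists_iso_graphB_rev hm
  obtain ⟨e', -⟩ := exists_iso_graphB_of_pendant h (by omega) hu (e.trans r) (by
    rw [RelIso.trans_apply, hr, Fin.val_rev, he]
    omega)
  obtain ⟨r', -⟩ := exists_iso_graphB_rev (n := m + 1) (s := m - 4 - s) (by omega)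
  rw [show m + 1 - 4 - (m - 4 - s) = s + 1 by omega] at r'
  exact ⟨e'.trans r'⟩

theorem exists_equiv_fin_map_two {V : Type*} [Fintype V] {n : ℕ} (hV : Fintype.card V = n)
    {p q : V} (hpq : p ≠ q) {a b : Fin n} (hab : a ≠ b) : ∃ e : V ≃ Fin n, e p = a ∧ e q = b := by
  let e₁ := (Fintype.equivFinOfCardEq hV).trans (Equiv.swap (Fintype.equivFinOfCardEq hV p) a)
  have h1 : e₁ p = a := by simp [e₁]
  refine ⟨e₁.trans (Equiv.swap (e₁ q) b), ?_, by simp⟩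
  rw [Equiv.trans_apply, h1, Equiv.swap_apply_of_ne_of_ne _ hab]
  rw [← h1]
  exact fun h => hpq (e₁.injective h)

theorem exists_equiv_fin_map_three {V : Type*} [Fintype V] {n : ℕ} (hV : Fintype.card V = n)
    {p q r : V} (hpq : p ≠ q) (hpr : p ≠ r) (hqr : q ≠ r) {a b c : Fin n} (hab : a ≠ b)
    (hac : a ≠ c) (hbc : b ≠ c) : ∃ e : V ≃ Fin n, e p = a ∧ e q = b ∧ e r = c := by
  obtain ⟨e₁, h1, h2⟩ := exists_equiv_fin_map_two hV hpq hab
  refine ⟨e₁.trans (Equiv.swap (e₁ r) c), ?_, ?_, by simp⟩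
  · rw [Equiv.trans_apply, h1, Equiv.swap_apply_of_ne_of_ne _ hac]
    rw [← h1]
    exact fun h => hpr (e₁.injective h)
  · rw [Equiv.trans_apply, h2, Equiv.swap_apply_of_ne_of_ne _ hbc]
    rw [← h2]
    exact fun h => hqr (e₁.injective h)

/-- The bicyclic graphs with four vertices, rooted at a vertex. -/
theorem exists_iso_of_card_eq_four {V : Type*} [Fintype V] {G : SimpleGraph V} (hG : IsBicyclic G)
    (hV : Fintype.card V = 4) (v : V) :
    (∃ e : G ≃g graphB 4 0, (e v).val = 3) ∨ ∃ e : G ≃g graphBOne 4, (e v).val = 3 := by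
  by_cases h : ∃ q, q ≠ v ∧ ¬ G.Adj v q
  · obtain ⟨q, hq, hvq⟩ := h
    obtain ⟨e, he1, he2⟩ := exists_equiv_fin_map_two hV hq.symm (by decide : (3 : Fin 4) ≠ 0)
    obtain ⟨e', he'⟩ := exists_iso_of_bijective_hom (G := G) (H := graphB 4 0) e e.bijective (by
      intro x y hxy
      have hne : e x ≠ e y := fun h => hxy.ne (e.injective h)
      have h1 : ¬ (e x = 3 ∧ e y = 0) := by
        rintro ⟨ha, hb⟩
        rw [← he1] at ha
        rw [← he2] at hb
        exact hvq (e.injective ha ▸ e.injective hb ▸ hxy)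
      have h2 : ¬ (e y = 3 ∧ e x = 0) := by
        rintro ⟨ha, hb⟩
        rw [← he1] at ha
        rw [← he2] at hb
        exact hvq (e.injective ha ▸ e.injective hb ▸ hxy.symm)
      rw [graphB_adj]
      have := (e x).isLt
      have := (e y).isLt
      simp only [Fin.ext_iff, Ne] at hne h1 h2 ⊢
      norm_num at hne h1 h2 ⊢
      omega)
      (by rw [hG.2, (isBicyclic_graphB (by omega) (by omega)).2, hV]; simp)
    exact Or.inl ⟨e', by rw [he', he1]; rfl⟩
  · push Not at h
    have hnon : ∃ p q, p ≠ q ∧ ¬ G.Adj p q := by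
      by_contra! hall
      have htop : G = ⊤ := by
        ext x y
        exact ⟨fun h => h.ne, fun h => hall x y h⟩
      have h1 := hG.2
      have h2 := card_edgeFinset_top_eq_card_choose_two (V := V)
      rw [htop, ← coe_edgeFinset, Set.ncard_coe_finset, h2, hV] at h1
      revert h1
      decide
    obtain ⟨p, q, hpq, hnpq⟩ := hnon
    have hpv : p ≠ v := by
      rintro rfl
      exact hnpq (h q hpq.symm)
    have hqv : q ≠ v := by
      rintro rfl
      exact hnpq (h p hpq).symm
    obtain ⟨e, he1, he2, he3⟩ := exists_equiv_fin_map_three hV hpq hpv hqv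
      (by decide : (0 : Fin 4) ≠ 1) (by decide : (0 : Fin 4) ≠ 3) (by decide)
    obtain ⟨e', he'⟩ := exists_iso_of_bijective_hom (G := G) (H := graphBOne 4) e e.bijective (by
      intro x y hxy
      have hne : e x ≠ e y := fun h => hxy.ne (e.injective h)
      have h1 : ¬ (e x = 0 ∧ e y = 1) := by
        rintro ⟨ha, hb⟩
        rw [← he1] at ha
        rw [← he2] at hb
        exact hnpq (e.injective ha ▸ e.injective hb ▸ hxy)
      have h2 : ¬ (e y = 0 ∧ e x = 1) := by
        rintro ⟨ha, hb⟩
        rw [← he1] at ha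
        rw [← he2] at hb
        exact hnpq (e.injective ha ▸ e.injective hb ▸ hxy.symm)
      rw [graphBOne_adj]
      have := (e x).isLt
      have := (e y).isLt
      simp only [Fin.ext_iff, Ne] at hne h1 h2 ⊢
      norm_num at hne h1 h2 ⊢
      omega)
      (by rw [hG.2, (isBicyclic_graphBOne (by omega)).2, hV]; simp)
    exact Or.inr ⟨e', by rw [he', he3]; rfl⟩

theorem exists_iso_of_card_eq_five {V : Type*} [Fintype V] {G : SimpleGraph V} (hG : IsBicyclic G)
    (hV : Fintype.card V = 5) {v x y : V} (hxy : x ≠ y) (hx : G.Adj v x) (hy : G.Adj v y)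
    (hD : 7 ≤ G.transmission v) : ∃ e : G ≃g graphB 5 1, (e v).val = 4 := by
  have hN1 := hG.1.numFar_one v
  have hN2 : G.numFar v 1 = _ + G.numFar v 2 := numFar_eq_add G v 1
  rw [card_dist_eq_one] at hN2
  have hdeg := two_le_ncard_of_adj hxy hx hy
  have hN := transmission_eq_add G v
  have hN3 : 0 < G.numFar v 3 := by
    by_contra! h0
    have := farSum_eq_zero (by omega : G.numFar v 3 = 0)
    omega
  obtain ⟨d, hd⟩ := hG.1.exists_dist_eq hN3
  obtain ⟨c, hcd, hc⟩ := hG.1.exists_adj_dist_succ (v := v) (x := d)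
    (by rintro rfl; rw [dist_self] at hd; omega)
  obtain ⟨a, hac, ha⟩ := hG.1.exists_adj_dist_succ (v := v) (x := c)
    (by rintro rfl; rw [dist_self] at hc; omega)
  obtain ⟨b, hba, hvb⟩ : ∃ b, b ≠ a ∧ G.Adj v b := by
    by_cases h : x = a
    · exact ⟨y, fun h' => hxy (h.trans h'.symm), hy⟩
    · exact ⟨x, h, hx⟩
  have hb : G.dist v b = 1 := dist_eq_one_iff_adj.2 hvb
  have hv0 : G.dist v v = 0 := dist_self
  let g : Fin 5 → V := ![d, c, a, b, v]
  have hgd : ∀ i, G.dist v (g i) = ![3, 2, 1, 1, 0] i := by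
    intro i
    fin_cases i
    exacts [hd, by change G.dist v c = 2; omega, by change G.dist v a = 1; omega, hb, hv0]
  have hinj : Function.Injective g := by
    intro i j hij
    have h1 : (![3, 2, 1, 1, 0] : Fin 5 → ℕ) i = (![3, 2, 1, 1, 0] : Fin 5 → ℕ) j := by
      rw [← hgd i, ← hgd j, hij]
    fin_cases i <;> fin_cases j <;> simp at h1 ⊢ <;> simp [g] at hij
    · exact hba hij.symm
    · exact hba hij
  have hbij : Function.Bijective g :=
    (Fintype.bijective_iff_injective_and_card g).2 ⟨hinj, by simp [hV]⟩
  let e := Equiv.ofBijective g hbij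
  obtain ⟨e', he'⟩ := exists_iso_of_bijective_hom (G := G) (H := graphB 5 1) e.symm
    e.symm.bijective (by
      intro p q hpq
      obtain ⟨i, rfl⟩ := e.surjective p
      obtain ⟨j, rfl⟩ := e.surjective q
      rw [Equiv.symm_apply_apply, Equiv.symm_apply_apply]
      have hne : i ≠ j := fun h => hpq.ne (by rw [h])
      have h1 := hG.1.dist_le_succ_of_adj (v := v) hpq
      have h2 := hG.1.dist_le_succ_of_adj (v := v) hpq.symm
      rw [show e i = g i from rfl, show e j = g j from rfl, hgd, hgd] at h1 h2
      clear hpq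
      rw [graphB_adj]
      revert i j
      decide)
    (by rw [hG.2, (isBicyclic_graphB (by omega) (by omega)).2, hV]; simp)
  refine ⟨e', ?_⟩
  rw [he']
  have : e 4 = v := rfl
  rw [← this, Equiv.symm_apply_apply]
  rfl

/-- A vertex `v` of a bicyclic graph has transmission smaller than that of the end of `B_n^{(1)}`,
unless the graph is `B(n, 0)`, `B(n, 1)` or `B_n^{(1)}` and `v` is the end of its long path. -/
theorem exists_iso_of_le_transmission (k : ℕ) : ∀ {V : Type*} [Fintype V] {G : SimpleGraph V}
    (v : V), IsBicyclic G → Fintype.card V = k + 4 →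
      (k + 4) ^ 2 ≤ 2 * G.transmission v + (k + 4) + 6 →
      (∃ e : G ≃g graphB (k + 4) 0, (e v).val = k + 3) ∨
      (1 ≤ k ∧ ∃ e : G ≃g graphB (k + 4) 1, (e v).val = k + 3) ∨
      (∃ e : G ≃g graphBOne (k + 4), (e v).val = k + 3) := by
  induction k with
  | zero =>
    intro V _ G v hG hV _
    rcases exists_iso_of_card_eq_four hG hV v with h | h
    · exact Or.inl h
    · exact Or.inr (Or.inr h)
  | succ k ih =>
    intro V _ G v hG hV hD
    rcases hG.1.pendant_or_two_neighbors (by omega) v with ⟨u, hu⟩ | ⟨a, b, hab, ha, hb⟩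
    · have hc := card_compl_singleton_add_one v
      have hT := transmission_of_pendant hG.1 hu
      have hG' := isBicyclic_induce_of_pendant hG hu
      rcases ih ⟨u, ((hu u).2 rfl).ne'⟩ hG' (by omega) (by nlinarith) with
        ⟨e, he⟩ | ⟨hk, e, he⟩ | ⟨e, he⟩
      · exact Or.inl (exists_iso_graphB_of_pendant hu (by omega) ((hu u).2 rfl).ne' e (by omega))
      · exact Or.inr (Or.inl ⟨by omega,
          exists_iso_graphB_of_pendant hu (by omega) ((hu u).2 rfl).ne' e (by omega)⟩)
      · exact Or.inr (Or.inr (exists_iso_graphBOne_of_pendant hu (by omega) ((hu u).2 rfl).ne' e (by omega)))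
    · have h1 := hG.1.two_mul_transmission_le_of_two_le (two_le_ncard_of_adj hab ha hb)
        (m := k + 2) hV
      obtain rfl : k = 0 := by nlinarith
      exact Or.inr (Or.inl ⟨le_rfl, exists_iso_of_card_eq_five hG hV hab ha hb (by omega)⟩)

end SimpleGraph

namespace SimpleGraph

/-! ### Bicyclic graphs without pendant vertices -/

open Finset
open scoped Classical

variable {V : Type*}

theorem eq_or_eq_of_ncard_eq_two {G : SimpleGraph V} {c p q y : V}
    (hc : (G.neighborSet c).ncard = 2) (hpq : p ≠ q) (hp : G.Adj c p) (hq : G.Adj c q)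
    (hy : G.Adj c y) : y = p ∨ y = q := by
  have hfin : (G.neighborSet c).Finite := Set.finite_of_ncard_ne_zero (by omega)
  have h : ({p, q} : Set V) = G.neighborSet c := by
    refine Set.eq_of_subset_of_ncard_le ?_ ?_ hfin
    · rintro z (rfl | rfl)
      exacts [hp, hq]
    · rw [hc, Set.ncard_pair hpq]
  have : y ∈ ({p, q} : Set V) := h ▸ hy
  exact this

theorem three_le_ncard_of_adj [Finite V] {G : SimpleGraph V} {v a b c : V} (hab : a ≠ b)
    (hac : a ≠ c) (hbc : b ≠ c) (ha : G.Adj v a) (hb : G.Adj v b) (hc : G.Adj v c) :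
    3 ≤ (G.neighborSet v).ncard := by
  have h3 : ({a, b, c} : Set V).ncard = 3 := Set.ncard_eq_three.2 ⟨a, b, c, hab, hac, hbc, rfl⟩
  rw [← h3]
  refine Set.ncard_le_ncard ?_ (Set.toFinite _)
  rintro x (rfl | rfl | rfl)
  exacts [ha, hb, hc]

variable [Fintype V]

/-- In a bicyclic graph without pendant vertices the degrees exceed `2` by `2` in total. -/
theorem sum_ncard_neighborSet_le {G : SimpleGraph V} (hG : IsBicyclic G)
    (hdeg : ∀ x, 2 ≤ (G.neighborSet x).ncard) (S : Finset V) :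
    ∑ x ∈ S, (G.neighborSet x).ncard ≤ 2 * #S + 2 := by
  have h1 := sum_ncard_neighborSet G
  rw [hG.2, ← sum_add_sum_compl S] at h1
  have h2 : 2 * #Sᶜ ≤ ∑ x ∈ Sᶜ, (G.neighborSet x).ncard := by
    rw [mul_comm, ← smul_eq_mul]
    exact card_nsmul_le_sum _ _ _ fun x _ => hdeg x
  have h3 := card_add_card_compl S
  omega

theorem Connected.card_le_of_closed {G : SimpleGraph V} (hG : G.Connected) (S : Finset V)
    (hS : S.Nonempty) (hcl : ∀ x ∈ S, ∀ y, G.Adj x y → y ∈ S) : Fintype.card V ≤ #S := by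
  refine card_le_card fun y _ => ?_
  exact hG.eq_univ_of_closed (S := (S : Set V)) hS hcl y

/-- If a vertex `v` of degree two, not a cut vertex, sees only one vertex at distance two, and if the
same holds for all other such vertices, then `v` lies in a triangle hanging at a vertex `b`. -/
theorem exists_pendant_triangle {G : SimpleGraph V} (hG : IsBicyclic G) (hn : 5 ≤ Fintype.card V)
    (hdeg : ∀ x, 2 ≤ (G.neighborSet x).ncard)
    (huniq : ∀ v, (G.induce {v}ᶜ).Connected → (G.neighborSet v).ncard = 2 →
      ∀ x y, G.dist v x = 2 → G.dist v y = 2 → x = y)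
    {v : V} (hv : (G.induce {v}ᶜ).Connected) (hv2 : (G.neighborSet v).ncard = 2) :
    ∃ a b w, (∀ x, G.Adj v x ↔ x = a ∨ x = b) ∧ (∀ x, G.Adj a x ↔ x = v ∨ x = b) ∧
      (∀ x, G.Adj b x ↔ x = v ∨ x = a ∨ x = w) ∧ w ≠ v ∧ w ≠ a := by
  obtain ⟨a, b, hab, hN⟩ := Set.ncard_eq_two.1 hv2
  have hNv : ∀ x, G.Adj v x ↔ x = a ∨ x = b := fun x => by
    rw [← mem_neighborSet, hN]; simp
  clear hN
  have hva : G.Adj v a := (hNv a).2 (Or.inl rfl)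
  have hvb : G.Adj v b := (hNv b).2 (Or.inr rfl)
  have hother : ∀ c, ∃ y, y ≠ v ∧ G.Adj c y := by
    intro c
    by_contra! h
    have h1 : G.neighborSet c ⊆ {v} := fun y hy => by_contra fun hne => h y hne hy
    have h2 := Set.ncard_le_ncard h1
    rw [Set.ncard_singleton] at h2
    have := hdeg c
    omega
  have hleave : ∀ S : Finset V, S.Nonempty → #S ≤ 4 → ∃ x ∈ S, ∃ y ∉ S, G.Adj x y := by
    intro S hS hS4
    by_contra! h
    have := hG.1.card_le_of_closed S hS fun x hx y hxy => by_contra fun hy => h x hx y hy hxy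
    omega
  have hD2 : ∀ c y, (c = a ∨ c = b) → G.Adj c y → y ≠ v → y ≠ a → y ≠ b → G.dist v y = 2 := by
    intro c y hc hcy hyv hya hyb
    refine hG.1.dist_eq_two ((hNv c).2 hc) hcy hyv fun h => ?_
    rcases (hNv y).1 h with h | h
    exacts [hya h, hyb h]
  by_cases hadj : G.Adj a b
  · -- the triangle `v, a, b`; as there are further vertices, `a` or `b` has another neighbour
    obtain ⟨c, hc, w, hw, hcw⟩ := hleave {v, a, b} ⟨v, by simp⟩ (card_le_three.trans (by omega))
    simp only [mem_insert, mem_singleton, not_or] at hc hw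
    obtain ⟨hwv, hwa, hwb⟩ := hw
    have hcab : c = a ∨ c = b := by
      rcases hc with rfl | hc
      · rcases (hNv w).1 hcw with h | h
        exacts [absurd h hwa, absurd h hwb]
      · exact hc
    clear hc
    wlog hcb : c = b generalizing a b
    · have := this b a hab.symm (fun x => by rw [hNv, or_comm]) hvb hva
        (fun c y hc => by rw [or_comm] at hc; intro h1 h2 h3 h4; exact hD2 c y hc h1 h2 h4 h3)
        hadj.symm hwb hwa hcab.symm (hcab.resolve_right hcb)
      exact this
    subst hcb
    have hw2 := hD2 c w hcab hcw hwv hwa hwb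
    have hNb : ∀ x, G.Adj c x ↔ x = v ∨ x = a ∨ x = w := by
      intro x
      constructor
      · intro hx
        by_contra! h
        exact h.2.2 (huniq v hv hv2 _ _ (hD2 c x (Or.inr rfl) hx h.1 h.2.1 hx.ne') hw2)
      · rintro (rfl | rfl | rfl)
        exacts [hvb.symm, hadj.symm, hcw]
    have hNa' : ∀ x, G.Adj a x → x = v ∨ x = c ∨ x = w := by
      intro x hx
      by_contra! h
      exact h.2.2 (huniq v hv hv2 _ _ (hD2 a x (Or.inl rfl) hx h.1 hx.ne' h.2.1) hw2)
    have haw : ¬ G.Adj a w := by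
      -- otherwise `a`, `b` and `w` all have degree at least three
      intro haw
      obtain ⟨d, hd, y, hy, hdy⟩ := hleave {v, a, c, w} ⟨v, by simp⟩ card_le_four
      simp only [mem_insert, mem_singleton, not_or] at hd hy
      obtain ⟨hyv, hya, hyc, hyw⟩ := hy
      have hdw : d = w := by
        rcases hd with rfl | rfl | rfl | rfl
        · rcases (hNv y).1 hdy with h | h
          exacts [absurd h hya, absurd h hyc]
        · rcases hNa' y hdy with h | h | h
          exacts [absurd h hyv, absurd h hyc, absurd h hyw]
        · rcases (hNb y).1 hdy with h | h | h
          exacts [absurd h hyv, absurd h hya, absurd h hyw]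
        · rfl
      subst hdw
      have h1 := three_le_ncard_of_adj hvb.ne (Ne.symm hwv) (Ne.symm hwb) hva.symm hadj haw
      have h2 := three_le_ncard_of_adj hva.ne (Ne.symm hwv) (Ne.symm hwa) hvb.symm hadj.symm hcw
      have h3 := three_le_ncard_of_adj hab (Ne.symm hya) (Ne.symm hyc) haw.symm hcw.symm hdy
      have h4 := sum_ncard_neighborSet_le hG hdeg {a, c, d}
      have h5 : #{a, c, d} ≤ 3 := card_le_three
      rw [sum_insert (by simp [hab, (Ne.symm hwa)]), sum_insert (by simp [(Ne.symm hwb)]),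
        sum_singleton] at h4
      omega
    refine ⟨a, c, w, hNv, fun x => ⟨fun hx => ?_, ?_⟩, hNb, hwv, hwa⟩
    · rcases hNa' x hx with h | h | h
      · exact Or.inl h
      · exact Or.inr h
      · exact absurd (h ▸ hx) haw
    · rintro (rfl | rfl)
      exacts [hva.symm, hadj]
  · -- `v, a, w, b` is a quadrangle, and `a` is a vertex with two vertices at distance two
    exfalso
    obtain ⟨w, hwv, haw⟩ := hother a
    have hwb : w ≠ b := by rintro rfl; exact hadj haw
    have hw2 := hD2 a w (Or.inl rfl) haw hwv haw.ne' hwb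
    have hNa : ∀ x, G.Adj a x → x = v ∨ x = w := by
      intro x hx
      by_contra! h
      exact h.2 (huniq v hv hv2 _ _ (hD2 a x (Or.inl rfl) hx h.1 hx.ne'
        (by rintro rfl; exact hadj hx)) hw2)
    have hNb : ∀ x, G.Adj b x → x = v ∨ x = w := by
      intro x hx
      by_contra! h
      exact h.2 (huniq v hv hv2 _ _ (hD2 b x (Or.inr rfl) hx h.1
        (by rintro rfl; exact hadj hx.symm) hx.ne') hw2)
    have hbw : G.Adj b w := by
      obtain ⟨y, hyv, hby⟩ := hother b
      rcases hNb y hby with h | h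
      · exact absurd h hyv
      · exact h ▸ hby
    obtain ⟨d, hd, y, hy, hdy⟩ := hleave {v, a, b, w} ⟨v, by simp⟩ card_le_four
    simp only [mem_insert, mem_singleton, not_or] at hd hy
    obtain ⟨hyv, hya, hyb, hyw⟩ := hy
    have hdw : d = w := by
      rcases hd with rfl | rfl | rfl | rfl
      · rcases (hNv y).1 hdy with h | h
        exacts [absurd h hya, absurd h hyb]
      · rcases hNa y hdy with h | h
        exacts [absurd h hyv, absurd h hyw]
      · rcases hNb y hdy with h | h
        exacts [absurd h hyv, absurd h hyw]
      · rfl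
    subst hdw
    have ha : (G.induce {a}ᶜ).Connected := hG.1.induce_compl_of_dominated hab.symm fun x hx => by
      rcases hNa x hx with rfl | rfl
      exacts [Or.inr hvb.symm, Or.inr hbw]
    have ha2 : (G.neighborSet a).ncard = 2 := by
      refine le_antisymm ?_ (hdeg a)
      rw [← Set.ncard_pair hwv]
      refine Set.ncard_le_ncard ?_ (Set.toFinite _)
      intro x hx
      exact (hNa x hx).symm
    refine hyb (huniq a ha ha2 y b ?_ ?_)
    · refine hG.1.dist_eq_two haw hdy hya fun h => ?_
      rcases hNa y h with h | h
      exacts [hyv h, hyw h]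
    · exact hG.1.dist_eq_two hva.symm hvb hab.symm hadj

/-- In the situation of `exists_pendant_triangle` all vertices of degree at least three are cut
vertices. -/
theorem ncard_eq_two_of_connected_induce {G : SimpleGraph V} (hG : IsBicyclic G)
    (hn : 5 ≤ Fintype.card V) (hdeg : ∀ x, 2 ≤ (G.neighborSet x).ncard)
    (huniq : ∀ v, (G.induce {v}ᶜ).Connected → (G.neighborSet v).ncard = 2 →
      ∀ x y, G.dist v x = 2 → G.dist v y = 2 → x = y)
    {p : V} (hp : (G.induce {p}ᶜ).Connected) : (G.neighborSet p).ncard = 2 := by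
  by_contra hne
  have hp3 : 3 ≤ (G.neighborSet p).ncard := by
    have := hdeg p
    omega
  -- a leaf of `G - p` is a neighbour of `p` of degree two
  obtain ⟨z, hpz, hz2⟩ : ∃ z, G.Adj p z ∧ (G.neighborSet z).ncard = 2 := by
    by_contra! h
    have h1 := sum_ncard_neighborSet G
    have h2 : (G.neighborSet p).ncard = ∑ z, if G.Adj p z then 1 else 0 := by
      rw [← card_filter, ← Set.ncard_coe_finset]
      congr 1
      ext x
      simp
    have h3 : ∑ z ∈ univ.erase p, (2 + if G.Adj p z then 1 else 0)
        ≤ ∑ z ∈ univ.erase p, (G.neighborSet z).ncard := by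
      refine sum_le_sum fun z _ => ?_
      have h4 := hdeg z
      split_ifs with h5
      · have := h z h5
        omega
      · omega
    rw [sum_add_distrib, sum_const, card_erase_of_mem (mem_univ p), card_univ] at h3
    have h4 := add_sum_erase univ (fun z => if G.Adj p z then 1 else 0) (mem_univ p)
    have h5 := add_sum_erase univ (fun z => (G.neighborSet z).ncard) (mem_univ p)
    rw [hG.2] at h1
    simp only [SimpleGraph.irrefl, if_false, zero_add, smul_eq_mul] at h3 h4 h5
    omega
  obtain ⟨t, htp, hzt⟩ : ∃ t, t ≠ p ∧ G.Adj z t := by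
    by_contra! h
    have h1 : G.neighborSet z ⊆ {p} := fun y hy => by_contra fun hne => h y hne hy
    have h2 := Set.ncard_le_ncard h1
    rw [Set.ncard_singleton] at h2
    omega
  have hNz : ∀ x, G.Adj z x → x = p ∨ x = t := fun x hx =>
    eq_or_eq_of_ncard_eq_two hz2 htp.symm hpz.symm hzt hx
  have hz : (G.induce {z}ᶜ).Connected := by
    let f : ({p}ᶜ : Set V) → ({z}ᶜ : Set V) := fun y =>
      if hy : (y : V) = z then ⟨t, hzt.ne'⟩ else ⟨y, hy⟩
    have hf : ∀ y (hy : y ≠ p) (hyz : y ≠ z), f ⟨y, hy⟩ = ⟨y, hyz⟩ := fun y hy hyz => by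
      simp [f, hyz]
    have hfz : f ⟨z, hpz.ne'⟩ = ⟨t, hzt.ne'⟩ := by simp [f]
    have key := hp.reachable_map (H := G.induce {z}ᶜ) f (by
      rintro ⟨x, hx⟩ ⟨y, hy⟩ hxy
      replace hxy : G.Adj x y := hxy
      by_cases hxz : x = z
      · subst hxz
        have hyt : y = t := (hNz y hxy).resolve_left hy
        subst hyt
        left
        rw [hfz, hf y hy hxy.ne']
      · by_cases hyz : y = z
        · subst hyz
          have hxt : x = t := (hNz x hxy.symm).resolve_left hx
          subst hxt
          left
          rw [hfz, hf x hx hxy.ne]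
        · right
          rw [hf x hx hxz, hf y hy hyz]
          exact hxy)
    have hreach : ∀ y (hy : y ≠ z), (G.induce {z}ᶜ).Reachable ⟨t, hzt.ne'⟩ ⟨y, hy⟩ := by
      intro y hy
      by_cases hyp : y = p
      · subst hyp
        obtain ⟨q, hqz, hyq⟩ : ∃ q, q ≠ z ∧ G.Adj y q := by
          by_contra! h
          have h1 : G.neighborSet y ⊆ {z} := fun x hx => by_contra fun hne => h x hne hx
          have h2 := Set.ncard_le_ncard h1
          rw [Set.ncard_singleton] at h2
          omega
        have h1 := key ⟨z, hpz.ne'⟩ ⟨q, hyq.ne'⟩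
        rw [hfz, hf q hyq.ne' hqz] at h1
        have h2 : (G.induce {z}ᶜ).Adj ⟨q, hqz⟩ ⟨y, hy⟩ := hyq.symm
        exact h1.trans h2.reachable
      · have h1 := key ⟨z, hpz.ne'⟩ ⟨y, hyp⟩
        rwa [hfz, hf y hyp hy] at h1
    refine (connected_iff _).2 ⟨fun x y => ?_, ⟨⟨t, hzt.ne'⟩⟩⟩
    exact (hreach x x.2).symm.trans (hreach y y.2)
  obtain ⟨a, b, w, hNz', hNa, hNb, -, -⟩ := exists_pendant_triangle hG hn hdeg huniq hz hz2
  rcases (hNz' p).1 hpz.symm with rfl | rfl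
  · have h1 : G.neighborSet p ⊆ {z, b} := fun x hx => (hNa x).1 hx
    have h2 := (Set.ncard_le_ncard h1 (Set.toFinite _)).trans (Set.ncard_insert_le _ _)
    rw [Set.ncard_singleton] at h2
    omega
  · have hza := (hNz' a).2 (Or.inl rfl)
    have hap := (hNa p).2 (Or.inr rfl)
    have h1 := hp.card_le_of_closed {⟨z, hpz.ne'⟩, ⟨a, hap.ne⟩} ⟨_, mem_insert_self _ _⟩ (by
      rintro ⟨x, hx⟩ hxS ⟨y, hy⟩ hxy
      replace hxy : G.Adj x y := hxy
      simp only [mem_insert, mem_singleton] at hxS ⊢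
      rcases hxS with h | h <;> obtain rfl := congrArg Subtype.val h
      · exact Or.inr (Subtype.ext (((hNz' y).1 hxy).resolve_right hy))
      · exact Or.inl (Subtype.ext (((hNa y).1 hxy).resolve_right hy)))
    have h2 := card_compl_singleton_add_one p
    have h3 : #({⟨z, hpz.ne'⟩, ⟨a, hap.ne⟩} : Finset ({p}ᶜ : Set V)) ≤ 2 := card_le_two
    omega

end SimpleGraph

namespace SimpleGraph

open Finset
open scoped Classical

variable {V : Type*}

/-- A geodesic `g 0, …, g k` does not enter a triangle hanging at `g 0`. -/
theorem geodesic_ne_of_triangle {G : SimpleGraph V} {g : ℕ → V} {k : ℕ}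
    (hg : ∀ i < k, G.Adj (g i) (g (i + 1))) (hd : ∀ i ≤ k, G.dist (g 0) (g i) = i) {c p : V}
    (hc : G.Adj (g 0) c) (hp : G.Adj (g 0) p) (hN : ∀ y, G.Adj c y → y = g 0 ∨ y = p)
    (hck : c ≠ g k) : ∀ i ≤ k, g i ≠ c := by
  rintro i hi rfl
  have h1 := hd i hi
  rw [dist_eq_one_iff_adj.2 hc] at h1
  subst h1
  have hk : 1 < k := lt_of_le_of_ne hi fun h => hck (h ▸ rfl)
  have h2 := hd 2 hk
  rcases hN _ (hg 1 hk) with h | h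
  · rw [h, dist_self] at h2
    omega
  · rw [h, dist_eq_one_iff_adj.2 hp] at h2
    omega

variable [Fintype V]

/-- A bicyclic graph in which two triangles `v, a, b` and `x, a', b'` hang at different
vertices `b` and `b'` consists of these triangles and a path joining them. -/
theorem nonempty_iso_graphBCycles {G : SimpleGraph V} (hG : IsBicyclic G)
    (hdeg : ∀ x, 2 ≤ (G.neighborSet x).ncard) {v a b w x a' b' w' : V} {n : ℕ}
    (hn : Fintype.card V = n)
    (hv : ∀ y, G.Adj v y ↔ y = a ∨ y = b) (ha : ∀ y, G.Adj a y ↔ y = v ∨ y = b)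
    (hb : ∀ y, G.Adj b y ↔ y = v ∨ y = a ∨ y = w) (hwv : w ≠ v) (hwa : w ≠ a)
    (hx : ∀ y, G.Adj x y ↔ y = a' ∨ y = b') (ha' : ∀ y, G.Adj a' y ↔ y = x ∨ y = b')
    (hb' : ∀ y, G.Adj b' y ↔ y = x ∨ y = a' ∨ y = w') (hwx : w' ≠ x) (hwa' : w' ≠ a')
    (hbb : b ≠ b') : Nonempty (G ≃g graphBCycles n 3 3) := by
  have hva := (hv a).2 (Or.inl rfl)
  have hvb := (hv b).2 (Or.inr rfl)
  have hab := (ha b).2 (Or.inr rfl)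
  have hbw := (hb w).2 (Or.inr (Or.inr rfl))
  have hxa := (hx a').2 (Or.inl rfl)
  have hxb := (hx b').2 (Or.inr rfl)
  have hab' := (ha' b').2 (Or.inr rfl)
  have hbw' := (hb' w').2 (Or.inr (Or.inr rfl))
  have hb3 := three_le_ncard_of_adj hva.ne hwv.symm hwa.symm hvb.symm hab.symm hbw
  have hb3' := three_le_ncard_of_adj hxa.ne hwx.symm hwa'.symm hxb.symm hab'.symm hbw'
  have hdeg2 : ∀ y, y ≠ b → y ≠ b' → (G.neighborSet y).ncard = 2 := by
    intro y h1 h2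
    have h3 := sum_ncard_neighborSet_le hG hdeg {y, b, b'}
    have h4 : #{y, b, b'} ≤ 3 := card_le_three
    rw [sum_insert (by simp [h1, h2]), sum_insert (by simp [hbb]), sum_singleton] at h3
    have := hdeg y
    omega
  have hle2 : ∀ c p q, (∀ y, G.Adj c y ↔ y = p ∨ y = q) → (G.neighborSet c).ncard ≤ 2 := by
    intro c p q h
    have h1 : G.neighborSet c = {p, q} := Set.ext fun y => h y
    rw [h1]
    exact (Set.ncard_insert_le _ _).trans (by rw [Set.ncard_singleton])
  -- the neighbours of the four outer vertices keep these away from `b`, `b'` and from each other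
  have hne : ∀ c, (G.neighborSet c).ncard ≤ 2 → c ≠ b ∧ c ≠ b' := fun c hc =>
    ⟨by rintro rfl; omega, by rintro rfl; omega⟩
  obtain ⟨-, hvb'⟩ := hne v (hle2 _ _ _ hv)
  obtain ⟨-, hab''⟩ := hne a (hle2 _ _ _ ha)
  obtain ⟨hxb', -⟩ := hne x (hle2 _ _ _ hx)
  obtain ⟨ha'b, -⟩ := hne a' (hle2 _ _ _ ha')
  have key : ∀ c p q r : V, G.Adj c b → c = p → (∀ y, G.Adj p y ↔ y = q ∨ y = r) → q ≠ b →
      r ≠ b → False := by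
    rintro c p q r h rfl h2 h3 h4
    rcases (h2 b).1 h with h | h
    exacts [h3 h.symm, h4 h.symm]
  have hvx : v ≠ x := fun h => key v x a' b' hvb h hx ha'b hbb.symm
  have hva' : v ≠ a' := fun h => key v a' x b' hvb h ha' hxb' hbb.symm
  have hax : a ≠ x := fun h => key a x a' b' hab h hx ha'b hbb.symm
  have haa' : a ≠ a' := fun h => key a a' x b' hab h ha' hxb' hbb.symm
  -- a geodesic from `b` to `b'`
  obtain ⟨p, hp⟩ := hG.1.exists_walk_length_eq_dist b b'
  obtain ⟨k, hk⟩ : ∃ k, p.length = k := ⟨_, rfl⟩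
  obtain ⟨g, hgdef⟩ : ∃ g : ℕ → V, g = p.getVert := ⟨_, rfl⟩
  have hg0 : g 0 = b := by rw [hgdef, p.getVert_zero]
  have hgk : g k = b' := by rw [hgdef, ← hk, p.getVert_length]
  have hk1 : 1 ≤ k := by
    rw [← hk, hp]
    exact hG.1.pos_dist_of_ne hbb
  have hgadj : ∀ i < k, G.Adj (g i) (g (i + 1)) := by
    intro i hi
    rw [hgdef]
    exact p.adj_getVert_succ (by omega)
  have hgd : ∀ i ≤ k, G.dist b (g i) = i ∧ G.dist b' (g i) = k - i := by
    intro i hi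
    have h1 : G.dist b (g i) ≤ i := by
      rw [hgdef]
      refine (dist_le (p.take i)).trans ?_
      simp
    have h2 : G.dist (g i) b' ≤ k - i := by
      rw [hgdef, ← hk]
      refine (dist_le (p.drop i)).trans ?_
      simp
    have h3 := hG.1.dist_triangle (u := b) (v := g i) (w := b')
    rw [dist_comm (u := b')]
    omega
  have hginj : ∀ i ≤ k, ∀ j ≤ k, g i = g j → i = j := by
    intro i hi j hj h
    have h1 := (hgd i hi).1
    rw [h, (hgd j hj).1] at h1
    exact h1.symm
  have hleft : ∀ i < k, G.Adj (g i) (g (i + 1)) := hgadj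
  have hright : ∀ i < k, G.Adj (g (k - i)) (g (k - (i + 1))) := by
    intro i hi
    have := (hgadj (k - (i + 1)) (by omega)).symm
    rwa [show k - (i + 1) + 1 = k - i by omega] at this
  have hdl : ∀ i ≤ k, G.dist (g 0) (g i) = i := fun i hi => by rw [hg0]; exact (hgd i hi).1
  have hdr : ∀ i ≤ k, G.dist (g (k - 0)) (g (k - i)) = i := by
    intro i hi
    rw [Nat.sub_zero, hgk, (hgd _ (by omega)).2]
    omega
  have hgv : ∀ i ≤ k, g i ≠ v := geodesic_ne_of_triangle hleft hdl (hg0 ▸ hvb.symm)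
    (hg0 ▸ hab.symm) (fun y hy => by rw [hg0]; exact ((hv y).1 hy).symm) (hgk ▸ hvb')
  have hga : ∀ i ≤ k, g i ≠ a := geodesic_ne_of_triangle hleft hdl (hg0 ▸ hab.symm)
    (hg0 ▸ hvb.symm) (fun y hy => by rw [hg0]; exact ((ha y).1 hy).symm) (hgk ▸ hab'')
  have hgx : ∀ i ≤ k, g i ≠ x := by
    intro i hi
    have := geodesic_ne_of_triangle (g := fun i => g (k - i)) hright hdr (c := x) (p := a')
      (by rw [Nat.sub_zero, hgk]; exact hxb.symm) (by rw [Nat.sub_zero, hgk]; exact hab'.symm)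
      (fun y hy => by rw [Nat.sub_zero, hgk]; exact ((hx y).1 hy).symm)
      (by rw [Nat.sub_self, hg0]; exact hxb') (k - i) (by omega)
    rwa [show k - (k - i) = i by omega] at this
  have hga' : ∀ i ≤ k, g i ≠ a' := by
    intro i hi
    have := geodesic_ne_of_triangle (g := fun i => g (k - i)) hright hdr (c := a') (p := x)
      (by rw [Nat.sub_zero, hgk]; exact hab'.symm) (by rw [Nat.sub_zero, hgk]; exact hxb.symm)
      (fun y hy => by rw [Nat.sub_zero, hgk]; exact ((ha' y).1 hy).symm)
      (by rw [Nat.sub_self, hg0]; exact ha'b) (k - i) (by omega)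
    rwa [show k - (k - i) = i by omega] at this
  -- all vertices have been found, since these vertices have no further neighbours
  let S : Set V := {y | y = v ∨ y = a ∨ (∃ i ≤ k, g i = y) ∨ y = a' ∨ y = x}
  have hgS : ∀ i ≤ k, g i ∈ S := fun i hi => Or.inr (Or.inr (Or.inl ⟨i, hi, rfl⟩))
  have hbS : b ∈ S := hg0 ▸ hgS 0 (by omega)
  have hbS' : b' ∈ S := hgk ▸ hgS k le_rfl
  have hvS : v ∈ S := Or.inl rfl
  have haS : a ∈ S := Or.inr (Or.inl rfl)
  have haS' : a' ∈ S := Or.inr (Or.inr (Or.inr (Or.inl rfl)))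
  have hxS : x ∈ S := Or.inr (Or.inr (Or.inr (Or.inr rfl)))
  have hcover : ∀ y, y ∈ S := by
    refine hG.1.eq_univ_of_closed ⟨v, hvS⟩ ?_
    rintro y (rfl | rfl | ⟨i, hi, rfl⟩ | rfl | rfl) z hyz
    · rcases (hv z).1 hyz with rfl | rfl
      exacts [haS, hbS]
    · rcases (ha z).1 hyz with rfl | rfl
      exacts [hvS, hbS]
    · by_cases hi0 : i = 0
      · subst hi0
        rw [hg0] at hyz
        rcases (hb z).1 hyz with rfl | rfl | rfl
        · exact hvS
        · exact haS
        · have h1 := hgadj 0 (by omega)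
          rw [hg0] at h1
          rcases (hb _).1 h1 with h | h | h
          · exact absurd h (hgv _ (by omega))
          · exact absurd h (hga _ (by omega))
          · exact h ▸ hgS _ (by omega)
      · by_cases hik : i = k
        · subst hik
          rw [hgk] at hyz
          rcases (hb' z).1 hyz with rfl | rfl | rfl
          · exact hxS
          · exact haS'
          · have h1 := hgadj (i - 1) (by omega)
            rw [Nat.sub_add_cancel (by omega), hgk] at h1
            rcases (hb' _).1 h1.symm with h | h | h
            · exact absurd h (hgx _ (by omega))
            · exact absurd h (hga' _ (by omega))
            · exact h ▸ hgS _ (by omega)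
        · have h2 := hdeg2 (g i)
            (fun h => hi0 (hginj i hi 0 (by omega) (h.trans hg0.symm)))
            (fun h => hik (hginj i hi k le_rfl (h.trans hgk.symm)))
          have h3 := hgadj (i - 1) (by omega)
          rw [Nat.sub_add_cancel (by omega)] at h3
          rcases eq_or_eq_of_ncard_eq_two h2
            (fun h => by have := hginj (i - 1) (by omega) (i + 1) (by omega) h; omega)
            h3.symm (hgadj i (by omega)) hyz with h | h
          · exact h ▸ hgS _ (by omega)
          · exact h ▸ hgS _ (by omega)
    · rcases (ha' z).1 hyz with rfl | rfl
      exacts [hxS, hbS']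
    · rcases (hx z).1 hyz with rfl | rfl
      exacts [haS', hbS']
  -- hence the vertices are `v, a, b = g 0, …, g k = b', a', x`
  let φ : ℕ → V := fun i => if i = 0 then v else if i = 1 then a else
    if i ≤ k + 2 then g (i - 2) else if i = k + 3 then a' else x
  have hφ0 : φ 0 = v := rfl
  have hφ1 : φ 1 = a := rfl
  have hφg : ∀ i, 2 ≤ i → i ≤ k + 2 → φ i = g (i - 2) := fun i h1 h2 => by
    simp only [φ]
    rw [if_neg (by omega), if_neg (by omega), if_pos h2]
  have hφ3 : φ (k + 3) = a' := by simp [φ]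
  have hφ4 : φ (k + 4) = x := by simp [φ]
  have hcases : ∀ i, i < k + 5 → i = 0 ∨ i = 1 ∨ (2 ≤ i ∧ i ≤ k + 2) ∨ i = k + 3 ∨ i = k + 4 := by
    intro i hi
    omega
  have hinj : ∀ i < k + 5, ∀ j < k + 5, i < j → φ i ≠ φ j := by
    intro i hi j hj hij
    rcases hcases i hi with rfl | rfl | ⟨hi1, hi2⟩ | rfl | rfl <;>
    rcases hcases j hj with rfl | rfl | ⟨hj1, hj2⟩ | rfl | rfl <;>
    first
    | omega
    | skip
    · rw [hφ0, hφ1]; exact hva.ne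
    · rw [hφ0, hφg j hj1 hj2]; exact (hgv _ (by omega)).symm
    · rw [hφ0, hφ3]; exact hva'
    · rw [hφ0, hφ4]; exact hvx
    · rw [hφ1, hφg j hj1 hj2]; exact (hga _ (by omega)).symm
    · rw [hφ1, hφ3]; exact haa'
    · rw [hφ1, hφ4]; exact hax
    · rw [hφg i hi1 hi2, hφg j hj1 hj2]
      intro h
      have := hginj _ (by omega) _ (by omega) h
      omega
    · rw [hφg i hi1 hi2, hφ3]; exact hga' _ (by omega)
    · rw [hφg i hi1 hi2, hφ4]; exact hgx _ (by omega)
    · rw [hφ3, hφ4]; exact hxa.ne'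
  have hbij : Function.Bijective fun i : Fin (k + 5) => φ i := by
    constructor
    · intro i j hij
      rcases lt_trichotomy i.val j.val with h | h | h
      · exact absurd hij (hinj _ i.isLt _ j.isLt h)
      · exact Fin.ext h
      · exact absurd hij.symm (hinj _ j.isLt _ i.isLt h)
    · intro y
      rcases hcover y with rfl | rfl | ⟨i, hi, rfl⟩ | rfl | rfl
      · exact ⟨⟨0, by omega⟩, hφ0⟩
      · exact ⟨⟨1, by omega⟩, hφ1⟩
      · refine ⟨⟨i + 2, by omega⟩, ?_⟩
        simp only
        rw [hφg _ (by omega) (by omega)]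
        rfl
      · exact ⟨⟨k + 3, by omega⟩, hφ3⟩
      · exact ⟨⟨k + 4, by omega⟩, hφ4⟩
  obtain rfl : n = k + 5 := by
    rw [← hn, ← Fintype.card_of_bijective hbij, Fintype.card_fin]
  have hadj : ∀ i < k + 5, ∀ j < k + 5,
      (j = i + 1 ∨ (i = 0 ∧ j + 1 = 3) ∨ (i + 3 = k + 5 ∧ j + 1 = k + 5)) →
      G.Adj (φ i) (φ j) := by
    rintro i hi j hj (rfl | ⟨rfl, h⟩ | ⟨h1, h2⟩)
    · rcases hcases i hi with rfl | rfl | ⟨hi1, hi2⟩ | rfl | rfl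
      · rw [hφ0, zero_add, hφ1]; exact hva
      · rw [hφ1, hφg _ (by omega) (by omega), hg0]; exact hab
      · rw [hφg i hi1 hi2]
        by_cases h : i = k + 2
        · subst h
          rw [hφ3, Nat.add_sub_cancel, hgk]
          exact hab'.symm
        · rw [hφg _ (by omega) (by omega), show i + 1 - 2 = i - 2 + 1 by omega]
          exact hgadj _ (by omega)
      · rw [hφ3, hφ4]; exact hxa.symm
      · omega
    · obtain rfl : j = 2 := by omega
      rw [hφ0, hφg _ (by omega) (by omega), hg0]; exact hvb
    · obtain rfl : i = k + 2 := by omega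
      obtain rfl : j = k + 4 := by omega
      rw [hφ4, hφg _ (by omega) (by omega), Nat.add_sub_cancel, hgk]
      exact hxb.symm
  obtain ⟨e, -⟩ := exists_iso_of_bijective_hom (G := graphBCycles (k + 5) 3 3) (H := G) _ hbij (by
    intro i j hij
    rw [graphBCycles_adj] at hij
    rcases hij.2 with h | h
    · exact hadj _ i.isLt _ j.isLt h
    · exact (hadj _ j.isLt _ i.isLt h).symm)
    (by rw [hG.2, (isBicyclic_graphBCycles (by omega)).2, hn, Fintype.card_fin])
  exact ⟨e.symm⟩

/-- A bicyclic graph without pendant vertices is `B_n^{3,3}` or has a vertex of degree two which is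
not a cut vertex and has at least two vertices at distance two. -/
theorem nonempty_iso_or_exists_dist_two {G : SimpleGraph V} (hG : IsBicyclic G) {n : ℕ}
    (hn : Fintype.card V = n) (hn5 : 5 ≤ n) (hdeg : ∀ x, 2 ≤ (G.neighborSet x).ncard) :
    Nonempty (G ≃g graphBCycles n 3 3) ∨ ∃ v, (G.induce {v}ᶜ).Connected ∧
      (G.neighborSet v).ncard = 2 ∧ ∃ x y, x ≠ y ∧ G.dist v x = 2 ∧ G.dist v y = 2 := by
  by_contra! h
  obtain ⟨hiso, huniq⟩ := h
  replace huniq : ∀ v, (G.induce {v}ᶜ).Connected → (G.neighborSet v).ncard = 2 →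
      ∀ x y, G.dist v x = 2 → G.dist v y = 2 → x = y := fun v h1 h2 x y hx hy =>
    by_contra fun hne => huniq v h1 h2 x y hne hx hy
  have hn5' : 5 ≤ Fintype.card V := by omega
  obtain ⟨v, hv⟩ := hG.1.exists_induce_compl (by omega)
  have hv2 := ncard_eq_two_of_connected_induce hG hn5' hdeg huniq hv
  obtain ⟨a, b, w, hNv, hNa, hNb, hwv, hwa⟩ :=
    exists_pendant_triangle hG hn5' hdeg huniq hv hv2
  have hvb := (hNv b).2 (Or.inr rfl)
  have hbw := (hNb w).2 (Or.inr (Or.inr rfl))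
  have hw2 : G.dist v w = 2 := hG.1.dist_eq_two hvb hbw hwv fun h => by
    rcases (hNv w).1 h with h | h
    exacts [hwa h, hbw.ne h.symm]
  obtain ⟨x, hvx, hx⟩ := hG.1.exists_farthest_ne (by omega) v
  have hxc := hG.1.induce_compl_of_farthest hvx hx
  have hx2 := ncard_eq_two_of_connected_induce hG hn5' hdeg huniq hxc
  obtain ⟨a', b', w', hNx, hNa', hNb', hwx, hwa'⟩ :=
    exists_pendant_triangle hG hn5' hdeg huniq hxc hx2
  have hxd : 2 ≤ G.dist v x := hw2 ▸ hx w
  have hnvx : ¬ G.Adj v x := fun h => by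
    rw [dist_eq_one_iff_adj.2 h] at hxd
    omega
  have hxa := (hNx a').2 (Or.inl rfl)
  have hxb := (hNx b').2 (Or.inr rfl)
  have hab' := (hNa' b').2 (Or.inr rfl)
  have hnxa : x ≠ a ∧ x ≠ b :=
    ⟨fun h => hnvx ((hNv x).2 (Or.inl h)), fun h => hnvx ((hNv x).2 (Or.inr h))⟩
  have hbb : b ≠ b' := by
    rintro rfl
    have hxw : x = w := by
      rcases (hNb x).1 hxb.symm with h | h | h
      exacts [absurd h.symm hvx, absurd h hnxa.1, h]
    rcases (hNb a').1 hab'.symm with rfl | rfl | h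
    · exact hnvx hxa.symm
    · rcases (hNa x).1 hxa.symm with h | h
      exacts [hvx h.symm, hnxa.2 h]
    · exact hxa.ne (hxw.trans h.symm)
  obtain ⟨e⟩ := nonempty_iso_graphBCycles hG hdeg hn hNv hNa hNb hwv hwa hNx hNa' hNb' hwx hwa' hbb
  exact hiso.false e

end SimpleGraph

namespace SimpleGraph

/-! ### The Wiener index of graphs without pendant vertices -/

open Finset
open scoped Classical

variable {V : Type*}

theorem Connected.dist_le_two {G : SimpleGraph V} (hG : G.Connected) {p q r : V}
    (h1 : G.Adj p q) (h2 : G.Adj q r) : G.dist p r ≤ 2 := by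
  have h3 := hG.dist_le_succ_of_adj (v := p) h2
  rw [dist_eq_one_iff_adj.2 h1] at h3
  exact h3

variable [Fintype V]

/-- Arithmetic core of `wienerIndex_le_of_card_eq_six`: the variables `ab`, …, `xy` stand for the
indicators of the possible edges between the two middle levels `{a, b}` and `{x, y}`, and `dab`, …
for distances, `z` being the vertex of the last level. -/
theorem sum_dist_middle_levels_le {ab ax ay bx by' xy dab dax day dbx dby dxy daz dbz : ℕ}
    (hab : ab = 0 ∨ ab = 1) (hax : ax = 0 ∨ ax = 1) (hay : ay = 0 ∨ ay = 1)
    (hbx : bx = 0 ∨ bx = 1) (hby : by' = 0 ∨ by' = 1) (hxy : xy = 0 ∨ xy = 1)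
    (hsum : ab + ax + ay + bx + by' + xy = 3) (hx : ax = 1 ∨ bx = 1) (hy : ay = 1 ∨ by' = 1)
    (ha : 1 ≤ ab + ax + ay) (hb : 1 ≤ ab + bx + by')
    (ab0 : ab = 0 ∨ dab = 1) (ax0 : ax = 0 ∨ dax = 1) (ay0 : ay = 0 ∨ day = 1)
    (bx0 : bx = 0 ∨ dbx = 1) (by0 : by' = 0 ∨ dby = 1) (xy0 : xy = 0 ∨ dxy = 1)
    (ab1 : dab ≤ 2) (xy1 : dxy ≤ 2) (ax3 : dax ≤ 3) (ay3 : day ≤ 3) (bx3 : dbx ≤ 3)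
    (by3 : dby ≤ 3)
    (ax1 : ab = 0 ∨ bx = 0 ∨ dax ≤ 2) (ax2 : ay = 0 ∨ xy = 0 ∨ dax ≤ 2)
    (ay1 : ab = 0 ∨ by' = 0 ∨ day ≤ 2) (ay2 : ax = 0 ∨ xy = 0 ∨ day ≤ 2)
    (bx1 : ab = 0 ∨ ax = 0 ∨ dbx ≤ 2) (bx2 : by' = 0 ∨ xy = 0 ∨ dbx ≤ 2)
    (by1 : ab = 0 ∨ ay = 0 ∨ dby ≤ 2) (by2 : bx = 0 ∨ xy = 0 ∨ dby ≤ 2)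
    (az1 : ax = 0 ∨ daz ≤ 2) (az2 : ay = 0 ∨ daz ≤ 2) (bz1 : bx = 0 ∨ dbz ≤ 2)
    (bz2 : by' = 0 ∨ dbz ≤ 2) (az3 : ab = 0 ∨ daz ≤ 1 + dbz) (bz3 : ab = 0 ∨ dbz ≤ 1 + daz) :
    dab + dax + day + dbx + dby + dxy + daz + dbz ≤ 14 := by
  rcases hax with rfl | rfl <;> rcases hbx with rfl | rfl <;>
    simp only [zero_ne_one, one_ne_zero, false_or, true_or, or_false, or_true] at * <;>
  rcases hay with rfl | rfl <;> rcases hby with rfl | rfl <;>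
    simp only [zero_ne_one, one_ne_zero, false_or, true_or, or_false, or_true] at * <;>
  rcases hab with rfl | rfl <;> rcases hxy with rfl | rfl <;>
    simp only [zero_ne_one, one_ne_zero, false_or, true_or, or_false, or_true] at * <;>
  omega

/-- The only case with six vertices in which the transmission of `v` is too large for the general
argument: the distance levels of `v` have sizes `1, 2, 2, 1`. -/
theorem wienerIndex_le_of_card_eq_six {G : SimpleGraph V} (hG : IsBicyclic G)
    (hV : Fintype.card V = 6) (hdeg : ∀ x, 2 ≤ (G.neighborSet x).ncard) {v x y z : V}
    (hv : (G.neighborSet v).ncard = 2) (hxy : x ≠ y) (hx : G.dist v x = 2) (hy : G.dist v y = 2)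
    (hz : G.dist v z = 3) : wienerIndex G ≤ 25 := by
  obtain ⟨a, b, hab, hN⟩ := Set.ncard_eq_two.1 hv
  have hva : G.Adj v a := by rw [← mem_neighborSet, hN]; simp
  have hvb : G.Adj v b := by rw [← mem_neighborSet, hN]; simp
  have ha : G.dist v a = 1 := dist_eq_one_iff_adj.2 hva
  have hb : G.dist v b = 1 := dist_eq_one_iff_adj.2 hvb
  have hv0 : G.dist v v = 0 := dist_self
  let g : Fin 6 → V := ![v, a, b, x, y, z]
  have hgd : ∀ i, G.dist v (g i) = ![0, 1, 1, 2, 2, 3] i := by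
    intro i
    fin_cases i
    exacts [hv0, ha, hb, hx, hy, hz]
  have hinj : Function.Injective g := by
    intro i j hij
    have h1 : (![0, 1, 1, 2, 2, 3] : Fin 6 → ℕ) i = (![0, 1, 1, 2, 2, 3] : Fin 6 → ℕ) j := by
      rw [← hgd i, ← hgd j, hij]
    fin_cases i <;> fin_cases j <;> simp at h1 ⊢ <;> simp [g] at hij
    · exact hab hij
    · exact hab hij.symm
    · exact hxy hij
    · exact hxy hij.symm
  have hbij : Function.Bijective g :=
    (Fintype.bijective_iff_injective_and_card g).2 ⟨hinj, by simp [hV]⟩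
  have hcov : ∀ c, c = v ∨ c = a ∨ c = b ∨ c = x ∨ c = y ∨ c = z := by
    intro c
    obtain ⟨i, rfl⟩ := hbij.2 c
    fin_cases i <;> simp [g]
  have hsum : ∀ f : V → ℕ, ∑ c, f c = f v + f a + f b + f x + f y + f z := by
    intro f
    rw [← (Equiv.ofBijective g hbij).sum_comp, Fin.sum_univ_six]
    rfl
  have hlev : ∀ p q, G.dist v p + 2 ≤ G.dist v q → ¬ G.Adj p q := by
    intro p q hpq hadj
    have := hG.1.dist_le_succ_of_adj (v := v) hadj
    omega
  -- the indicator of adjacency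
  let E : V → V → ℕ := fun p q => if G.Adj p q then 1 else 0
  have hE1 : ∀ p q, E p q = 0 ∨ E p q = 1 ∧ G.Adj p q := by
    intro p q
    by_cases h : G.Adj p q
    · exact Or.inr ⟨by simp [E, h], h⟩
    · exact Or.inl (by simp [E, h])
  have hEp : ∀ p q, G.Adj p q → E p q = 1 := fun p q h => by simp [E, h]
  have hE0 : ∀ p q, ¬ G.Adj p q → E p q = 0 := fun p q h => by simp [E, h]
  have hEs : ∀ p, E p p = 0 := fun p => by simp [E]
  have hEc : ∀ p q, E p q = E q p := fun p q => by simp [E, G.adj_comm]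
  have hEd : ∀ p, (G.neighborSet p).ncard = E p v + E p a + E p b + E p x + E p y + E p z := by
    intro p
    rw [← hsum fun q => E p q, ← card_filter, ← Set.ncard_coe_finset]
    congr 1
    ext q
    simp
  have hxl : E a x = 1 ∨ E b x = 1 := by
    obtain ⟨c, hc, hcd⟩ := hG.1.exists_adj_dist_succ (v := v) (x := x)
      (by rintro rfl; rw [dist_self] at hx; omega)
    rcases hcov c with rfl | rfl | rfl | rfl | rfl | rfl
    · omega
    · exact Or.inl (hEp _ _ hc)
    · exact Or.inr (hEp _ _ hc)
    all_goals omega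
  have hyl : E a y = 1 ∨ E b y = 1 := by
    obtain ⟨c, hc, hcd⟩ := hG.1.exists_adj_dist_succ (v := v) (x := y)
      (by rintro rfl; rw [dist_self] at hy; omega)
    rcases hcov c with rfl | rfl | rfl | rfl | rfl | rfl
    · omega
    · exact Or.inl (hEp _ _ hc)
    · exact Or.inr (hEp _ _ hc)
    all_goals omega
  have hEsum := sum_ncard_neighborSet G
  rw [hsum, hG.2, hV] at hEsum
  have hda := hdeg a
  have hdb := hdeg b
  have hdz := hdeg z
  simp only [hEd] at hEsum hda hdb hdz
  rw [hEs, hEc a v, hEp v a hva, hE0 a z (hlev _ _ (by omega))] at hda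
  rw [hEs, hEc b v, hEp v b hvb, hE0 b z (hlev _ _ (by omega)), hEc b a] at hdb
  rw [hEs, hEc z v, hEc z a, hEc z b, hE0 v z (hlev _ _ (by omega)),
    hE0 a z (hlev _ _ (by omega)), hE0 b z (hlev _ _ (by omega))] at hdz
  simp only [hEs, hEc a v, hEc b v, hEc x v, hEc y v, hEc z v, hEc b a, hEc x a, hEc x b, hEc y a,
    hEc y b, hEc y x, hEc z a, hEc z b, hEp v a hva, hEp v b hvb, hE0 v x (hlev _ _ (by omega)),
    hE0 v y (hlev _ _ (by omega)), hE0 v z (hlev _ _ (by omega)), hE0 a z (hlev _ _ (by omega)),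
    hE0 b z (hlev _ _ (by omega))] at hEsum
  obtain ⟨hzx1, hzx⟩ : E z x = 1 ∧ G.Adj z x := by
    rcases hE1 z x with h | h
    · rcases hE1 z y with h' | h' <;> omega
    · exact h
  obtain ⟨hzy1, hzy⟩ : E z y = 1 ∧ G.Adj z y := by
    rcases hE1 z y with h | h
    · omega
    · exact h
  rw [hEc x z, hEc y z] at hEsum
  have hW := two_mul_wienerIndex G
  simp only [hsum, transmission] at hW
  simp only [dist_self, dist_comm (u := a) (v := v), dist_comm (u := b) (v := v),
    dist_comm (u := x) (v := v), dist_comm (u := y) (v := v), dist_comm (u := z) (v := v),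
    dist_comm (u := b) (v := a), dist_comm (u := x) (v := a), dist_comm (u := y) (v := a),
    dist_comm (u := z) (v := a), dist_comm (u := x) (v := b), dist_comm (u := y) (v := b),
    dist_comm (u := z) (v := b), dist_comm (u := y) (v := x), dist_comm (u := x) (v := z),
    dist_comm (u := y) (v := z), ha, hb, hx, hy, hz, dist_eq_one_iff_adj.2 hzx,
    dist_eq_one_iff_adj.2 hzy] at hW
  have dab := hG.1.dist_le_two hva.symm hvb
  have dxy := hG.1.dist_le_two hzx.symm hzy
  have far3 : ∀ c d, G.Adj v c → G.dist v d = 2 → G.dist c d ≤ 3 := by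
    intro c d hc hd
    have := hG.1.dist_triangle (u := c) (v := v) (w := d)
    rw [dist_eq_one_iff_adj.2 hc.symm] at this
    omega
  have dax := far3 a x hva hx
  have day := far3 a y hva hy
  have dbx := far3 b x hvb hx
  have dby := far3 b y hvb hy
  have one : ∀ p q, E p q = 0 ∨ G.dist p q = 1 := fun p q =>
    (hE1 p q).imp_right fun h => dist_eq_one_iff_adj.2 h.2
  have two : ∀ p q r, E p q = 0 ∨ E q r = 0 ∨ G.dist p r ≤ 2 := fun p q r =>
    (hE1 p q).imp_right fun h => (hE1 q r).imp_right fun h' => hG.1.dist_le_two h.2 h'.2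
  have az1 := two a x z
  have az2 := two a y z
  have bz1 := two b x z
  have bz2 := two b y z
  have az3 : E a b = 0 ∨ G.dist a z ≤ 1 + G.dist b z :=
    (hE1 a b).imp_right fun h => by
      have := hG.1.dist_triangle (u := a) (v := b) (w := z)
      rwa [dist_eq_one_iff_adj.2 h.2] at this
  have bz3 : E a b = 0 ∨ G.dist b z ≤ 1 + G.dist a z :=
    (hE1 a b).imp_right fun h => by
      have := hG.1.dist_triangle (u := b) (v := a) (w := z)
      rwa [dist_eq_one_iff_adj.2 h.2.symm] at this
  have ax1 := two a b x
  have ax2 := two a y x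
  have ay1 := two a b y
  have ay2 := two a x y
  have bx1 := two b a x
  have bx2 := two b y x
  have by1 := two b a y
  have by2 := two b x y
  rw [hEc x z] at az1 bz1
  rw [hEc y z] at az2 bz2
  rw [hEc y x] at ax2 bx2
  rw [hEc b a] at bx1 by1
  have ab0 := one a b
  have ax0 := one a x
  have ay0 := one a y
  have bx0 := one b x
  have by0 := one b y
  have xy0 := one x y
  have key := sum_dist_middle_levels_le ((hE1 a b).imp_right And.left) ((hE1 a x).imp_right And.left)
    ((hE1 a y).imp_right And.left) ((hE1 b x).imp_right And.left) ((hE1 b y).imp_right And.left)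
    ((hE1 x y).imp_right And.left) (by omega) hxl hyl (by omega) (by omega) ab0 ax0 ay0 bx0 by0 xy0
    dab dxy dax day dbx dby ax1 ax2 ay1 ay2 bx1 bx2 by1 by2 (az1.imp_right (Or.resolve_left · (by omega)))
    (az2.imp_right (Or.resolve_left · (by omega))) (bz1.imp_right (Or.resolve_left · (by omega)))
    (bz2.imp_right (Or.resolve_left · (by omega))) az3 bz3
  omega

theorem two_neighbors_of_two_le_ncard {G : SimpleGraph V}
    (hdeg : ∀ x, 2 ≤ (G.neighborSet x).ncard) (x : V) :
    ∃ a b, a ≠ b ∧ G.Adj x a ∧ G.Adj x b := by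
  obtain ⟨a, b, ha, hb, hab⟩ := (Set.one_lt_ncard_iff (Set.toFinite _)).1 (hdeg x)
  exact ⟨a, b, hab, ha, hb⟩

/-- Deleting a vertex `v` as in `nonempty_iso_or_exists_dist_two` leaves a graph to which
`six_mul_wienerIndex_le_of_card_le` applies. -/
theorem six_mul_wienerIndex_le_of_no_pendant {G : SimpleGraph V} (hG : IsBicyclic G) {m : ℕ}
    (hn : Fintype.card V = m + 5) (hdeg : ∀ x, 2 ≤ (G.neighborSet x).ncard)
    (hiso : ¬ Nonempty (G ≃g graphBCycles (m + 5) 3 3)) :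
    6 * wienerIndex G + 19 * (m + 5) ≤ (m + 5) ^ 3 + 54 ∧
    (1 ≤ m → 6 * wienerIndex G + 19 * (m + 5) + 6 ≤ (m + 5) ^ 3 + 54) := by
  obtain ⟨v, hvc, hv2, x, y, hxy, hx, hy⟩ :=
    (nonempty_iso_or_exists_dist_two hG hn (by omega) hdeg).resolve_left hiso
  obtain ⟨h3, hD⟩ := hG.1.two_mul_transmission_le_of_dist_two hv2.ge hxy hx hy hn
  have h1 := wienerIndex_le_induce_add hvc
  have hc := card_compl_singleton_add_one v
  have he := ncard_edgeSet_eq_add G v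
  rw [hG.2, hv2] at he
  have h2 := hvc.six_mul_wienerIndex_le_of_card_le (m + 3) (by omega) (by omega)
  have hS := hG.1.two_mul_farSum_le h3
  refine ⟨by nlinarith, fun hm => ?_⟩
  rcases Nat.lt_or_ge m 2 with hm2 | hm2
  · obtain rfl : m = 1 := by omega
    rcases Nat.eq_zero_or_pos (G.numFar v 3) with h0 | h0
    · rw [farSum_eq_zero h0] at hD
      omega
    · obtain ⟨z, hz⟩ := hG.1.exists_dist_eq h0
      have := wienerIndex_le_of_card_eq_six hG hn hdeg hv2 hxy hx hy hz
      omega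
  · have hS' := hG.1.two_mul_farSum_add_two_le (two_neighbors_of_two_le_ncard hdeg) hm2 h3
    nlinarith

end SimpleGraph

namespace SimpleGraph

/-! ### Induction on the number of vertices -/

open Finset
open scoped Classical

theorem wienerIndex_of_card_eq_four {V : Type*} [Fintype V] {G : SimpleGraph V}
    (hG : IsBicyclic G) (hV : Fintype.card V = 4) : wienerIndex G = 7 := by
  obtain ⟨v⟩ := hG.1.nonempty
  rcases exists_iso_of_card_eq_four hG hV v with ⟨e, -⟩ | ⟨e, -⟩
  · have := six_mul_wienerIndex_graphB_zero (le_refl 4)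
    rw [e.wienerIndex_eq hG.1]
    omega
  · have := six_mul_wienerIndex_graphBOne (le_refl 4)
    rw [e.wienerIndex_eq hG.1]
    omega

/-- If deleting a pendant vertex from `G` leaves `B(m, 0)`, then `G` is `B(m + 1, 0)` or
`B(m + 1, 1)`, or its Wiener index is small. -/
theorem six_mul_wienerIndex_le_of_iso_graphB_zero {V : Type*} [Fintype V] {G : SimpleGraph V}
    (hG : IsBicyclic G) {m : ℕ} (hV : Fintype.card V = m + 1) (hm : 5 ≤ m) {v u : V}
    (hu : ∀ x, G.Adj v x ↔ x = u) (h0 : ¬ Nonempty (G ≃g graphB (m + 1) 0))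
    (h1 : ¬ Nonempty (G ≃g graphB (m + 1) 1)) (e : G.induce {v}ᶜ ≃g graphB m 0) :
    6 * wienerIndex G + 19 * (m + 1) + 6 ≤ (m + 1) ^ 3 + 54 := by
  have hG' := isBicyclic_induce_of_pendant hG hu
  have hW := wienerIndex_le_induce_add hG'.1
  have hT := transmission_of_pendant hG.1 hu
  rw [← e.transmission_eq hG'.1] at hT
  rw [e.wienerIndex_eq hG'.1] at hW
  have hW0 := six_mul_wienerIndex_graphB_zero (by omega : 4 ≤ m)
  have hlt := (e ⟨u, ((hu u).2 rfl).ne'⟩).isLt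
  have hlast : (e ⟨u, ((hu u).2 rfl).ne'⟩).val + 1 ≠ m := fun h => by
    obtain ⟨e', -⟩ := exists_iso_graphB_of_pendant hu (by omega) _ e h
    exact h0 ⟨e'⟩
  have hfirst : (e ⟨u, ((hu u).2 rfl).ne'⟩).val ≠ 0 := fun h =>
    h1 (exists_iso_graphB_of_pendant_first hu (by omega) _ e h)
  have hD := two_mul_transmission_graphB_zero_le hm (e ⟨u, ((hu u).2 rfl).ne'⟩) (by omega)
    (by omega)
  nlinarith

theorem six_mul_wienerIndex_le_of_iso_graphB_one {V : Type*} [Fintype V] {G : SimpleGraph V}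
    (hG : IsBicyclic G) {m : ℕ} (hV : Fintype.card V = m + 1) (hm : 6 ≤ m) {v u : V}
    (hu : ∀ x, G.Adj v x ↔ x = u) (h1 : ¬ Nonempty (G ≃g graphB (m + 1) 1))
    (h2 : m = 7 → ¬ Nonempty (G ≃g graphB (m + 1) 2)) (e : G.induce {v}ᶜ ≃g graphB m 1) :
    6 * wienerIndex G + 19 * (m + 1) + 6 ≤ (m + 1) ^ 3 + 54 := by
  have hG' := isBicyclic_induce_of_pendant hG hu
  have hW := wienerIndex_le_induce_add hG'.1
  have hT := transmission_of_pendant hG.1 hu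
  rw [← e.transmission_eq hG'.1] at hT
  rw [e.wienerIndex_eq hG'.1] at hW
  have hW0 := six_mul_wienerIndex_graphB_one (by omega : 5 ≤ m)
  have hlt := (e ⟨u, ((hu u).2 rfl).ne'⟩).isLt
  have hlast : (e ⟨u, ((hu u).2 rfl).ne'⟩).val + 1 ≠ m := fun h => by
    obtain ⟨e', -⟩ := exists_iso_graphB_of_pendant hu (by omega) _ e h
    exact h1 ⟨e'⟩
  by_cases hfirst : (e ⟨u, ((hu u).2 rfl).ne'⟩).val = 0
  · have hiso := exists_iso_graphB_of_pendant_first hu (by omega) _ e hfirst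
    have hm6 : m ≠ 6 := by
      rintro rfl
      -- `B(7, 2)` is `B(7, 1)` read backwards
      obtain ⟨e'⟩ := hiso
      obtain ⟨r, -⟩ := exists_iso_graphB_rev (n := 7) (s := 2) (by omega)
      exact h1 ⟨e'.trans r⟩
    have hm7 : m ≠ 7 := fun h => h2 h hiso
    have hD := two_mul_transmission_graphB_one_first (by omega) _ hfirst
    have hm8 : 8 ≤ m := by omega
    nlinarith
  · have hD := two_mul_transmission_graphB_one_le hm (e ⟨u, ((hu u).2 rfl).ne'⟩) (by omega)
      (by omega)
    nlinarith

theorem six_mul_wienerIndex_le_of_iso_graphBCycles {V : Type*} [Fintype V] {G : SimpleGraph V}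
    (hG : IsBicyclic G) {m : ℕ} (hV : Fintype.card V = m + 1) (hm : 5 ≤ m) {v u : V}
    (hu : ∀ x, G.Adj v x ↔ x = u) (e : G.induce {v}ᶜ ≃g graphBCycles m 3 3) :
    6 * wienerIndex G + 19 * (m + 1) + 6 ≤ (m + 1) ^ 3 + 54 := by
  have hG' := isBicyclic_induce_of_pendant hG hu
  have hW := wienerIndex_le_induce_add hG'.1
  have hT := transmission_of_pendant hG.1 hu
  rw [← e.transmission_eq hG'.1] at hT
  rw [e.wienerIndex_eq hG'.1] at hW
  have hW0 := six_mul_wienerIndex_graphBCycles hm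
  have hD := two_mul_transmission_graphBCycles_le hm (e ⟨u, ((hu u).2 rfl).ne'⟩)
  nlinarith

/-- The inductive step for a graph with a pendant vertex; `hweak` is the induction hypothesis. -/
theorem six_mul_wienerIndex_add_six_le_of_pendant {V : Type*} [Fintype V] {G : SimpleGraph V}
    (hG : IsBicyclic G) {m : ℕ} (hV : Fintype.card V = m + 1) (hm : 5 ≤ m) {v u : V}
    (hu : ∀ x, G.Adj v x ↔ x = u)
    (hweak : ¬ Nonempty (G.induce {v}ᶜ ≃g graphB m 0) → ¬ Nonempty (G.induce {v}ᶜ ≃g graphB m 1) →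
      ¬ Nonempty (G.induce {v}ᶜ ≃g graphBCycles m 3 3) →
      6 * wienerIndex (G.induce {v}ᶜ) + 19 * m ≤ m ^ 3 + 54)
    (h0 : ¬ Nonempty (G ≃g graphB (m + 1) 0)) (h1 : ¬ Nonempty (G ≃g graphB (m + 1) 1))
    (hOne : ¬ Nonempty (G ≃g graphBOne (m + 1)))
    (h2 : m = 7 → ¬ Nonempty (G ≃g graphB (m + 1) 2)) :
    6 * wienerIndex G + 19 * (m + 1) + 6 ≤ (m + 1) ^ 3 + 54 := by
  by_cases c0 : Nonempty (G.induce {v}ᶜ ≃g graphB m 0)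
  · obtain ⟨e⟩ := c0
    exact six_mul_wienerIndex_le_of_iso_graphB_zero hG hV hm hu h0 h1 e
  by_cases c1 : Nonempty (G.induce {v}ᶜ ≃g graphB m 1)
  · obtain ⟨e⟩ := c1
    have hm6 : m ≠ 5 := by
      rintro rfl
      -- `B(5, 1)` is `B(5, 0)` read backwards
      obtain ⟨r, -⟩ := exists_iso_graphB_rev (n := 5) (s := 1) (by omega)
      exact c0 ⟨e.trans r⟩
    exact six_mul_wienerIndex_le_of_iso_graphB_one hG hV (by omega) hu h1 h2 e
  by_cases c3 : Nonempty (G.induce {v}ᶜ ≃g graphBCycles m 3 3)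
  · obtain ⟨e⟩ := c3
    exact six_mul_wienerIndex_le_of_iso_graphBCycles hG hV hm hu e
  have hW' := hweak c0 c1 c3
  have hW := wienerIndex_le_induce_add (isBicyclic_induce_of_pendant hG hu).1
  have hD : 2 * G.transmission v + m + 7 < (m + 1) ^ 2 := by
    by_contra! hD
    obtain ⟨k, rfl⟩ := Nat.exists_eq_add_of_le' (by omega : 3 ≤ m)
    rcases exists_iso_of_le_transmission k v hG hV (by nlinarith) with
      ⟨e, -⟩ | ⟨-, e, -⟩ | ⟨e, -⟩
    exacts [h0 ⟨e⟩, h1 ⟨e⟩, hOne ⟨e⟩]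
  -- `(m + 1) ^ 2 - (m + 1)` is even, which sharpens the strict inequality
  obtain ⟨t, ht⟩ := Nat.even_mul_succ_self m
  have hD' : G.transmission v + 4 ≤ t := by nlinarith
  nlinarith

/-- Bicyclic graphs with `n` vertices other than `B(n, 0)`, `B(n, 1)` and `B_n^{3,3}` have Wiener
index at most that of `B_n^{(1)}`, and even smaller if `n ≥ 6`, up to the listed exceptions. -/
theorem six_mul_wienerIndex_le_of_isBicyclic (k : ℕ) : ∀ {V : Type*} [Fintype V]
    {G : SimpleGraph V}, IsBicyclic G → Fintype.card V = k + 4 →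
      ¬ Nonempty (G ≃g graphB (k + 4) 0) → ¬ Nonempty (G ≃g graphB (k + 4) 1) →
      ¬ Nonempty (G ≃g graphBCycles (k + 4) 3 3) →
      6 * wienerIndex G + 19 * (k + 4) ≤ (k + 4) ^ 3 + 54 ∧
      (2 ≤ k → ¬ Nonempty (G ≃g graphBOne (k + 4)) →
        (k = 4 → ¬ Nonempty (G ≃g graphB (k + 4) 2)) →
        6 * wienerIndex G + 19 * (k + 4) + 6 ≤ (k + 4) ^ 3 + 54) := by
  induction k with
  | zero =>
    intro V _ G hG hV _ _ _
    rw [wienerIndex_of_card_eq_four hG hV]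
    exact ⟨by norm_num, by omega⟩
  | succ k ih =>
    intro V _ G hG hV h0 h1 h3
    by_cases hdeg : ∀ x, 2 ≤ (G.neighborSet x).ncard
    · obtain ⟨hle, hlt⟩ := six_mul_wienerIndex_le_of_no_pendant hG hV hdeg h3
      exact ⟨hle, fun hk _ _ => hlt (by omega)⟩
    push Not at hdeg
    obtain ⟨v, hv⟩ := hdeg
    obtain ⟨u, hu⟩ : ∃ u, ∀ x, G.Adj v x ↔ x = u := by
      refine (hG.1.pendant_or_two_neighbors (by omega) v).resolve_right ?_
      rintro ⟨a, b, hab, ha, hb⟩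
      have := two_le_ncard_of_adj hab ha hb
      omega
    have hG' := isBicyclic_induce_of_pendant hG hu
    have hc := card_compl_singleton_add_one v
    have hOneW := six_mul_wienerIndex_graphBOne (by omega : 4 ≤ k + 1 + 4)
    rcases Nat.eq_zero_or_pos k with rfl | hk
    · refine ⟨?_, by omega⟩
      by_cases hD : 7 ≤ G.transmission v
      · rcases exists_iso_of_le_transmission 1 v hG hV (by norm_num; omega) with
          ⟨e, -⟩ | ⟨-, e, -⟩ | ⟨e, -⟩
        · exact absurd ⟨e⟩ h0
        · exact absurd ⟨e⟩ h1
        · rw [e.wienerIndex_eq hG.1]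
          exact hOneW.le
      · have hW := wienerIndex_le_induce_add hG'.1
        rw [wienerIndex_of_card_eq_four hG' (by omega)] at hW
        omega
    · have hstep := six_mul_wienerIndex_add_six_le_of_pendant hG hV (by omega) hu
        (fun c0 c1 c3 => (ih hG' (by omega) c0 c1 c3).1) h0 h1
      refine ⟨?_, fun _ hOne h2 => hstep hOne fun h => h2 (by omega)⟩
      by_cases hOne : Nonempty (G ≃g graphBOne (k + 1 + 4))
      · obtain ⟨e⟩ := hOne
        rw [e.wienerIndex_eq hG.1, hOneW]
      by_cases h2 : k + 4 = 7 → ¬ Nonempty (G ≃g graphB (k + 1 + 4) 2)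
      · have := hstep hOne h2
        rw [show k + 4 + 1 = k + 1 + 4 by omega] at this
        omega
      · push Not at h2
        obtain ⟨hk7, ⟨e⟩⟩ := h2
        obtain rfl : k = 3 := by omega
        rw [e.wienerIndex_eq hG.1, wienerIndex_graphB_eight_two]
        norm_num

theorem wienerIndex_lt_graphBOne {n : ℕ} (hn : 6 ≤ n) {V : Type*} [Fintype V] {G : SimpleGraph V}
    (hV : Fintype.card V = n) (hG : IsBicyclic G) (h0 : ¬ Nonempty (G ≃g graphB n 0))
    (h1 : ¬ Nonempty (G ≃g graphB n 1)) (hOne : ¬ Nonempty (G ≃g graphBOne n))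
    (h3 : ¬ Nonempty (G ≃g graphBCycles n 3 3)) (h2 : n = 8 → ¬ Nonempty (G ≃g graphB n 2)) :
    wienerIndex G < wienerIndex (graphBOne n) := by
  obtain ⟨k, rfl⟩ := Nat.exists_eq_add_of_le' (by omega : 4 ≤ n)
  have h := (six_mul_wienerIndex_le_of_isBicyclic k hG hV h0 h1 h3).2 (by omega) hOne
    fun hk => h2 (by omega)
  have := six_mul_wienerIndex_graphBOne (by omega : 4 ≤ k + 4)
  omega

end SimpleGraph

theorem theorem2p2 (n : ℕ) (hn : 6 ≤ n) :
    -- the four distinguished graphs are bicyclic graphs of order n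
    (IsBicyclic (graphB n 0) ∧ IsBicyclic (graphBCycles n 3 3) ∧
      IsBicyclic (graphB n 1) ∧ IsBicyclic (graphBOne n)) ∧
    -- the value of the Wiener index of the last one
    (wienerIndex (graphBOne n) : ℚ) = ((n : ℚ) ^ 3 - 19 * (n : ℚ) + 54) / 6 ∧
    -- (i) the case n = 6
    (n = 6 →
      (∀ (V : Type u) [Fintype V] (G : SimpleGraph V),
        Fintype.card V = n → IsBicyclic G →
        ¬ Nonempty (G ≃g graphB n 0) → ¬ Nonempty (G ≃g graphB n 1) →
        ¬ Nonempty (G ≃g graphBOne n) → ¬ Nonempty (G ≃g graphBCycles n 3 3) →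
        wienerIndex G < wienerIndex (graphBOne n)) ∧
      wienerIndex (graphBOne n) < wienerIndex (graphB n 1) ∧
      wienerIndex (graphB n 1) = wienerIndex (graphBCycles n 3 3) ∧
      wienerIndex (graphBCycles n 3 3) < wienerIndex (graphB n 0)) ∧
    -- (ii) the case n = 8
    (n = 8 →
      IsBicyclic (graphB n 2) ∧
      (∀ (V : Type u) [Fintype V] (G : SimpleGraph V),
        Fintype.card V = n → IsBicyclic G →
        ¬ Nonempty (G ≃g graphB n 0) → ¬ Nonempty (G ≃g graphB n 1) →
        ¬ Nonempty (G ≃g graphBOne n) → ¬ Nonempty (G ≃g graphBCycles n 3 3) →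
        ¬ Nonempty (G ≃g graphB n 2) →
        wienerIndex G < wienerIndex (graphB n 2)) ∧
      wienerIndex (graphB n 2) = wienerIndex (graphBOne n) ∧
      wienerIndex (graphBOne n) < wienerIndex (graphB n 1) ∧
      wienerIndex (graphB n 1) < wienerIndex (graphBCycles n 3 3) ∧
      wienerIndex (graphBCycles n 3 3) < wienerIndex (graphB n 0)) ∧
    -- (iii) all other n
    (7 ≤ n → n ≠ 8 →
      (∀ (V : Type u) [Fintype V] (G : SimpleGraph V),
        Fintype.card V = n → IsBicyclic G →
        ¬ Nonempty (G ≃g graphB n 0) → ¬ Nonempty (G ≃g graphB n 1) →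
        ¬ Nonempty (G ≃g graphBOne n) → ¬ Nonempty (G ≃g graphBCycles n 3 3) →
        wienerIndex G < wienerIndex (graphBOne n)) ∧
      wienerIndex (graphBOne n) < wienerIndex (graphB n 1) ∧
      wienerIndex (graphB n 1) < wienerIndex (graphBCycles n 3 3) ∧
      wienerIndex (graphBCycles n 3 3) < wienerIndex (graphB n 0)) := by
  have w0 := SimpleGraph.six_mul_wienerIndex_graphB_zero (by omega : 4 ≤ n)
  have w1 := SimpleGraph.six_mul_wienerIndex_graphB_one (by omega : 5 ≤ n)
  have wOne := SimpleGraph.six_mul_wienerIndex_graphBOne (by omega : 4 ≤ n)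
  have w3 := SimpleGraph.six_mul_wienerIndex_graphBCycles (by omega : 5 ≤ n)
  refine ⟨⟨SimpleGraph.isBicyclic_graphB (by omega) (by omega),
    SimpleGraph.isBicyclic_graphBCycles (by omega), SimpleGraph.isBicyclic_graphB (by omega) (by omega),
    SimpleGraph.isBicyclic_graphBOne (by omega)⟩, ?_, ?_, ?_, ?_⟩
  · have h : (6 * (wienerIndex (graphBOne n) : ℚ) + 19 * n) = (n : ℚ) ^ 3 + 54 := by
      exact_mod_cast wOne
    linarith
  · intro h6
    refine ⟨fun V _ G hV hG h0 h1 hOne h3 => SimpleGraph.wienerIndex_lt_graphBOne hn hV hG h0 h1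
      hOne h3 fun h => by omega, by omega, ?_, by omega⟩
    subst h6
    omega
  · intro h8
    have w2 : wienerIndex (graphB n 2) = 69 := by
      rw [h8]
      exact SimpleGraph.wienerIndex_graphB_eight_two
    have w : wienerIndex (graphB n 2) = wienerIndex (graphBOne n) := by
      subst h8
      omega
    refine ⟨SimpleGraph.isBicyclic_graphB le_rfl (by omega), ?_, w, by omega, by omega, by omega⟩
    intro V _ G hV hG h0 h1 hOne h3 h2
    rw [w]
    exact SimpleGraph.wienerIndex_lt_graphBOne hn hV hG h0 h1 hOne h3 fun _ => h2
  · intro h7 h8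
    refine ⟨fun V _ G hV hG h0 h1 hOne h3 => SimpleGraph.wienerIndex_lt_graphBOne hn hV hG h0 h1
      hOne h3 fun h => absurd h h8, by omega, by omega, by omega⟩
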